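/- For a nonzero integer $D$ let $E_D:\ y^2=x^3+Dx$, and for an odd prime $p\nmid D$ put $a_p(E_D)=1+p-\#E_D(\mathbb F_p)$. For an integer $r$ let $Q(r,N)$ be the set of primes $p\le N$ of the form $p=r^2+x^2$ with $x\in\mathbb Z$, and let $$a_p(2r)=\lim_{N\to\infty}\frac{\#\{p\in Q(r,N):\ p\nmid 2D,\ a_p(E_D)=2r\}}{\#Q(r,N)}$$ whenever this limit exists. Hardy–Littlewood Conjecture. Let $a,b,c$ be integers with $a>0$, $\gcd(a,b,c)=1$, $a+b$ and $c$ not both even, and $\Delta=b^2-4ac$ not a square. Let $P(n)$ be the number of primes less than $n$ of the form $ax^2+bx+c$ with $x$ a nonnegative integer. Then $P(n)\sim\delta(a,b,c)\,\sqrt n/\log n$ as $n\to\infty$, where $$\delta(a,b,c)=\frac{\gcd(2,a+b)}{\sqrt a}\prod_{\substack{p\mid a,\ p\mid b\\ p>2}}\frac{p}{p-1}\ \prod_{\substack{p\nmid a\\ p>2}}\Bigl(1-\frac{(\Delta/p)}{p-1}\Bigr),$$ the last product being taken over the primes in increasing order. Notation. Let $D=\pm2^{\sigma}p_1\cdots p_r(q_1\cdots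 q_s)^2(l_1\cdots l_t)^3$ with $0\le\sigma\le 3$ and $p_i,q_i,l_i$ distinct odd primes (that is, $D\neq0$ is not divisible by the fourth power of a prime), and let $\beta>0$ be an even integer. Write $D=d\bar d$, where $d>0$ is odd, $\gcd(d,\bar d)=1$, every prime factor of $d$ divides $\beta$, and no odd prime factor of $\bar d$ divides $\beta$. Let $\bar d_p$ and $\bar d_l$ be the products of the odd primes that divide $\bar d$ exactly to the first power and exactly to the third power respectively, and let $r''$ and $t''$ be the numbers of prime factors of $\bar d_p$ and of $\bar d_l$. Let $\tau$ be the multiplicative function on positive integers with $\tau(1)=1$, $\tau(l^k)=l^k$ for a prime $l=2$ or $l\equiv3\pmod 4$, and $\tau(l^k)=l^{k-1}(l-2)$ for a prime $l\equiv1\pmod 4$ ($k\ge1$). Theorem. Assume the Hardy–Littlewood Conjecture, and assume that $D$ is odd or $4\,\|\,D$. Then the densities $a_p(2\beta)$ and $a_p(-2\beta)$ exist and are equal, and their common value is as follows. (1) If $d=1$, then $$a_p(2\beta)=a_p(-2\beta)=\frac14\left(1-\frac{(-1)^{r+t}}{\tau(p_1\cdots p_r\,l_1\cdots l_t)}\right).$$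 (2) If $\bar d$ has no odd prime factor, then $a_p(2\beta)=a_p(-2\beta)=0$. (3) If $\bar d$ has some odd prime factor, then $$a_p(2\beta)=a_p(-2\beta)=\frac14\left(1-\frac{(-1)^{r''+t''}}{\tau(\bar d_p\,\bar d_l)}\right).$$ -/

import Mathlib

open Filter Topology

noncomputable section

/-- The number `P(n)` of primes less than `n` that are of the form `a x² + b x + c` with `x` a
nonnegative integer. -/
def quadPrimeCount (a b c : ℤ) (n : ℕ) : ℕ :=
  Set.ncard {p : ℕ | p.Prime ∧ p < n ∧ ∃ x : ℕ, (p : ℤ) = a * (x : ℤ) ^ 2 + b * (x : ℤ) + c}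

/-- The infinite product `∏ (1 - (Δ/p) / (p - 1))`, `Δ = b² - 4ac`, over the odd primes `p` not
dividing `a`. It is only conditionally convergent, so it is taken in increasing order of `p`. For an
odd prime `p` the Jacobi symbol is the Legendre symbol. -/
def hlProduct (a b c : ℤ) : ℝ :=
  limUnder atTop fun N : ℕ =>
    ∏ p ∈ (Finset.range (N + 1)).filter (fun p : ℕ => p.Prime ∧ 2 < p ∧ ¬ (p : ℤ) ∣ a),
      (1 - (jacobiSym (b ^ 2 - 4 * a * c) p : ℝ) / ((p : ℝ) - 1))

/-- The Hardy-Littlewood constant `δ(a, b, c)`. -/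
def hlConst (a b c : ℤ) : ℝ :=
  (Int.gcd 2 (a + b) : ℝ) / Real.sqrt (a : ℝ)
    * (∏ p ∈ a.natAbs.primeFactors.filter (fun p : ℕ => 2 < p ∧ (p : ℤ) ∣ b),
        (p : ℝ) / ((p : ℝ) - 1))
    * hlProduct a b c

/-- The Hardy-Littlewood conjecture on primes represented by quadratic polynomials. -/
def HardyLittlewoodConjecture : Prop :=
  ∀ a b c : ℤ, 0 < a → Int.gcd (Int.gcd a b) c = 1 → ¬ (Even (a + b) ∧ Even c) →
    ¬ IsSquare (b ^ 2 - 4 * a * c) →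
    Asymptotics.IsEquivalent atTop (fun n : ℕ => (quadPrimeCount a b c n : ℝ))
      (fun n : ℕ => hlConst a b c * (Real.sqrt (n : ℝ) / Real.log (n : ℝ)))

/-- The curve `E_D : y² = x³ + D x`. -/
def curveE (D : ℤ) : WeierstrassCurve ℤ where
  a₁ := 0
  a₂ := 0
  a₃ := 0
  a₄ := D
  a₆ := 0

/-- `a_p(E_D) = 1 + p - #E_D(𝔽_p)`, used for odd primes `p` not dividing `D`. -/
def frobTrace (D : ℤ) (p : ℕ) : ℤ :=
  1 + (p : ℤ) -
    (Nat.card ((curveE D).map (Int.castRingHom (ZMod p))).toAffine.Point : ℤ)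

/-- `Q(r, N)`: the primes `p ≤ N` of the form `r² + x²`. -/
def quadPrimes (r : ℤ) (N : ℕ) : Set ℕ :=
  {p : ℕ | p.Prime ∧ p ≤ N ∧ ∃ x : ℤ, (p : ℤ) = r ^ 2 + x ^ 2}

/-- The density `a_p(E_D, 2r)` exists and equals `δ`. -/
def HasTraceDensity (D r : ℤ) (δ : ℝ) : Prop :=
  Tendsto
    (fun N : ℕ =>
      (Set.ncard {p : ℕ | p ∈ quadPrimes r N ∧ ¬ (p : ℤ) ∣ 2 * D ∧ frobTrace D p = 2 * r} : ℝ)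
        / (Set.ncard (quadPrimes r N) : ℝ))
    atTop (𝓝 δ)

/-- The multiplicative function with `τ(l^k) = l^k` for a prime `l = 2` or `l ≡ 3 (mod 4)`, and
`τ(l^k) = l^(k-1) (l - 2)` for a prime `l ≡ 1 (mod 4)`. -/
def tau (n : ℕ) : ℕ :=
  ∏ l ∈ n.primeFactors,
    if l % 4 = 1 then l ^ (n.factorization l - 1) * (l - 2) else l ^ n.factorization l

/-- The odd primes dividing `n` with exponent exactly `i`. For
`n = ± 2^σ p₁⋯p_r (q₁⋯q_s)² (l₁⋯l_t)³` (distinct odd primes) these are the `p_j`, the `q_j` and the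
`l_j` for `i = 1, 2, 3`. -/
def oddPrimesExp (n : ℤ) (i : ℕ) : Finset ℕ :=
  n.natAbs.primeFactors.filter fun l => l ≠ 2 ∧ n.natAbs.factorization l = i

/-- `D = d * dbar`, where `d` is positive, odd and prime to `dbar`, every prime factor of `d` divides
`β`, and no odd prime factor of `dbar` divides `β`. -/
structure IsSplitting (D β d dbar : ℤ) : Prop where
  eq_mul : D = d * dbar
  pos : 0 < d
  odd : Odd d
  coprime : IsCoprime d dbar
  dvd_of_dvd : ∀ l : ℕ, l.Prime → (l : ℤ) ∣ d → (l : ℤ) ∣ β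
  not_dvd_of_dvd : ∀ l : ℕ, l.Prime → l ≠ 2 → (l : ℤ) ∣ dbar → ¬ (l : ℤ) ∣ β

/-- For `n = ± 2^σ P Q² L³` with `P, Q, L` odd, square-free and pairwise coprime, having `u`, `v`, `w`
prime factors respectively, this is `(1 - (-1)^(u + w) / τ(P L)) / 4`. -/
def densityValue (n : ℤ) : ℝ :=
  (1 / 4 : ℝ) *
    (1 - (-1 : ℝ) ^ ((oddPrimesExp n 1).card + (oddPrimesExp n 3).card)
      / (tau ((∏ l ∈ oddPrimesExp n 1, l) * ∏ l ∈ oddPrimesExp n 3, l) : ℝ))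

end

/-!
Let `p = x² + β²` be a large prime, with `β` even. Choose the sign of `x` so that `x ≡ β - 1`
modulo `4`. Then `x + β i` is the Jacobi sum `J(χ, χ²)` of a quartic character `χ` modulo `p`
(`exists_quartic_jacobiSum_eq`), and counting points gives
`a_p(E_D) = -χ(-1) (χ̄(D) (x + β i) + χ(D) (x - β i))`. Hence the trace is `2 β` or `-2 β` exactly when
`D` is a quadratic non-residue modulo `p`, the sign being decided by which of the two primitive fourth
roots of unity `χ(D)` is (`frobTrace_eq_iff`).

Whether `D` is a non-residue is, by quadratic reciprocity, a condition on `x` modulo the odd prime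
factors `l` of `D`; the prime `2` does not interfere because it divides `D` to the power `0` or `2`.
The sign is treated by rational quartic reciprocity. In characteristic `l` the Frobenius map applied to
the Gauss sum of `χ`, whose fourth power is `J(χ, χ²)² p`, expresses `χ(l)` through `x + β i` modulo
`l`. Therefore `χ(l)` depends only on `x` modulo `l` (and `4`), and becomes its inverse when `x` is
replaced by `-x` modulo `l` (`quarticChar_apply_prime`). So the trace depends only on the class of `x`
modulo `M = 4 ∏ l`, and the involution of classes that is the identity modulo `4` and `-1` modulo every
`l` exchanges the traces `2 β` and `-2 β` (`frobTrace_eq_iff_of_modEq`).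

The Hardy–Littlewood conjecture for the polynomials `(M y + r)² + β²`, whose constant is independent of
`r` (`hlConst_shift`), says that the classes `r` with `r² + β²` prime to `M` contain equally many
primes. This needs the constant to be nonzero, that is, the convergence of its conditionally convergent
product to a nonzero limit (`hlProduct_ne_zero`), which follows from Mertens' theorem for the character
modulo `4`. The density of each of the traces `± 2 β` is thus half the proportion of classes in which
`D` is a non-residue, that is `(1 - A) / 4`, where `A` is the average of `(D | x² + β²)` over the
admissible classes.

By the Chinese remainder theorem `A` is a product of local averages. The factor at `l` is `1` if `l`
divides `β` or has even exponent in `D`. Otherwise it is `-1 / τ(l)`: the sum of `(x² + β² | l)` over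
`x` is `-1`, and `τ(l)` is the number of `x` with `x² + β²` nonzero modulo `l`.
-/

/-! ### Point counts on `y² = x³ + D x` -/

/-- The number of affine points above `x` is `1 + (x³ + D x | p)`, so the trace of Frobenius is minus
a sum of Legendre symbols. -/
theorem frobTrace_eq_neg_sum {p : ℕ} [Fact p.Prime] {D : ℤ} (hp : p ≠ 2) (hD : ¬ (p : ℤ) ∣ D) :
    frobTrace D p = -∑ x : ZMod p, quadraticChar (ZMod p) (x ^ 3 + (D : ZMod p) * x) := by
  classical
  have hchar : ringChar (ZMod p) ≠ 2 := by rwa [ZMod.ringChar_zmod_n]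
  have hD0 : (D : ZMod p) ≠ 0 := by
    rwa [Ne, ZMod.intCast_zmod_eq_zero_iff_dvd]
  have h2 : (2 : ZMod p) ≠ 0 := Ring.two_ne_zero hchar
  set W := ((curveE D).map (Int.castRingHom (ZMod p))).toAffine with hW
  have hΔ : W.Δ ≠ 0 := by
    have : W.Δ = -(2 : ZMod p) ^ 6 * (D : ZMod p) ^ 3 := by
      simp [hW, curveE, WeierstrassCurve.Δ, WeierstrassCurve.b₂, WeierstrassCurve.b₄,
        WeierstrassCurve.b₆, WeierstrassCurve.b₈]
      ring
    rw [this]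
    exact mul_ne_zero (neg_ne_zero.mpr (pow_ne_zero _ h2)) (pow_ne_zero _ hD0)
  let e : {xy : ZMod p × ZMod p // W.Nonsingular xy.1 xy.2} ≃
      Σ x : ZMod p, {y : ZMod p // y ∈ {y : ZMod p | y ^ 2 = x ^ 3 + (D : ZMod p) * x}.toFinset} :=
    { toFun := fun xy => ⟨xy.1.1, xy.1.2, by
        have := (W.equation_iff_nonsingular_of_Δ_ne_zero hΔ).mpr xy.2
        rw [WeierstrassCurve.Affine.equation_iff] at this
        simpa [hW, curveE] using this⟩
      invFun := fun s => ⟨(s.1, s.2.1), by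
        rw [← W.equation_iff_nonsingular_of_Δ_ne_zero hΔ, WeierstrassCurve.Affine.equation_iff]
        have := s.2.2
        simpa [hW, curveE] using this⟩
      left_inv := fun _ => rfl
      right_inv := fun _ => rfl }
  have hcard : Nat.card W.Point
      = 1 + ∑ x : ZMod p, {y : ZMod p | y ^ 2 = x ^ 3 + (D : ZMod p) * x}.toFinset.card := by
    have h1 : Nat.card W.Point = Nat.card (Option {xy : ZMod p × ZMod p // W.Nonsingular xy.1 xy.2}) :=
      Nat.card_congr (WeierstrassCurve.Affine.nonsingularPointEquiv W)
    rw [h1, Finite.card_option, Nat.card_congr e, Nat.card_eq_fintype_card, Fintype.card_sigma,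
      add_comm]
    simp only [Fintype.card_coe]
  have hsum : ((∑ x : ZMod p, {y : ZMod p | y ^ 2 = x ^ 3 + (D : ZMod p) * x}.toFinset.card : ℕ) : ℤ)
      = ∑ x : ZMod p, quadraticChar (ZMod p) (x ^ 3 + (D : ZMod p) * x) + p := by
    push_cast
    simp_rw [quadraticChar_card_sqrts hchar]
    rw [Finset.sum_add_distrib]
    simp
  unfold frobTrace
  rw [← hW, hcard]
  push_cast at hsum ⊢
  rw [hsum]
  ring

/-! ### Quartic characters and the Jacobi sum `J(χ, χ²)` -/

/-- A multiplicative character of exact order two on a finite field is the quadratic character. -/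
theorem MulChar.eq_quadraticChar_of_sq_eq_one {F R : Type*} [Field F] [Fintype F] [DecidableEq F]
    [CommRing R] [IsDomain R] {ψ : MulChar F R} (h1 : ψ ≠ 1) (h2 : ψ ^ 2 = 1) :
    ψ = (quadraticChar F).ringHomComp (Int.castRingHom R) := by
  have hsq : ∀ a : F, a ≠ 0 → ψ a ^ 2 = 1 := fun a ha => by
    rw [← MulChar.pow_apply' _ two_ne_zero, h2, MulChar.one_apply ha.isUnit]
  obtain ⟨a₀, ha₀⟩ := MulChar.ne_one_iff.mp h1
  have hs : ∀ a : F, a ≠ 0 → IsSquare a → ψ a = 1 := by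
    rintro a ha ⟨b, rfl⟩
    rw [map_mul, ← sq, hsq b (by rintro rfl; simp at ha)]
  have ha₀' : ¬ IsSquare (a₀ : F) := fun h => ha₀ (hs _ a₀.ne_zero h)
  have ha₀1 : ψ a₀ = -1 :=
    (eq_or_eq_neg_of_sq_eq_sq _ _ ((hsq _ a₀.ne_zero).trans (one_pow 2).symm)).resolve_left
      ha₀
  ext a
  have ha := a.ne_zero
  rw [MulChar.ringHomComp_apply]
  by_cases h : IsSquare (a : F)
  · rw [hs _ ha h, (quadraticChar_one_iff_isSquare ha).mpr h, map_one]
  · have hq := quadraticChar_neg_one_iff_not_isSquare.mpr h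
    have hq₀ := quadraticChar_neg_one_iff_not_isSquare.mpr ha₀'
    have : ψ (a * a₀) = 1 := by
      apply hs _ (mul_ne_zero ha a₀.ne_zero)
      rw [← quadraticChar_one_iff_isSquare (mul_ne_zero ha a₀.ne_zero), map_mul, hq, hq₀]
      norm_num
    rw [map_mul, ha₀1] at this
    rw [hq]
    simp only [map_neg, map_one]
    linear_combination -this

/-- The imaginary unit of the Gaussian integers. -/
def GaussianInt.I : GaussianInt := ⟨0, 1⟩

namespace GaussianInt

theorem I_sq : I ^ 2 = -1 := by decide

theorem star_I : star I = -I := by decide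

theorem eq_of_pow_four_eq_one {z : GaussianInt} (h : z ^ 4 = 1) :
    z = 1 ∨ z = -1 ∨ z = I ∨ z = -I := by
  have : (z - 1) * ((z + 1) * ((z - I) * (z + I))) = 0 := by
    linear_combination h + (1 - z ^ 2) * I_sq
  simp only [mul_eq_zero, sub_eq_zero, add_eq_zero_iff_eq_neg] at this
  tauto

theorem mul_star_of_pow_four_eq_one {z : GaussianInt} (h : z ^ 4 = 1) : z * star z = 1 := by
  rcases eq_of_pow_four_eq_one h with rfl | rfl | rfl | rfl <;> decide

theorem star_eq_pow_three {z : GaussianInt} (h : z ^ 4 = 1) : star z = z ^ 3 := by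
  linear_combination -star z * h + z ^ 3 * mul_star_of_pow_four_eq_one h

theorem isPrimitiveRoot_I : IsPrimitiveRoot I 4 := by
  rw [IsPrimitiveRoot.iff_def]
  refine ⟨by decide, fun l hl => ?_⟩
  have h4 : I ^ (l % 4) = 1 := by
    rw [← hl]; conv_rhs => rw [← Nat.div_add_mod l 4, pow_add, pow_mul]
    rw [show I ^ 4 = 1 by decide, one_pow, one_mul]
  have : l % 4 < 4 := Nat.mod_lt _ (by norm_num)
  apply Nat.dvd_of_mod_eq_zero
  interval_cases h : l % 4
  · rfl
  all_goals exact absurd h4 (by decide)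

end GaussianInt

open GaussianInt

theorem sq_ne_one_of_orderOf {M : Type*} [Group M] {χ : M} (hχ : orderOf χ = 4) : χ ^ 2 ≠ 1 :=
    fun h => by
  have := orderOf_dvd_of_pow_eq_one h
  rw [hχ] at this
  omega

theorem ne_one_of_orderOf {M : Type*} [Group M] {χ : M} (hχ : orderOf χ = 4) : χ ≠ 1 := fun h => by
  rw [h, orderOf_one] at hχ
  omega

theorem cube_ne_one_of_orderOf {M : Type*} [Group M] {χ : M} (hχ : orderOf χ = 4) : χ * χ ^ 2 ≠ 1 :=
    fun h => by
  rw [← pow_succ'] at h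
  have := orderOf_dvd_of_pow_eq_one h
  rw [hχ] at this
  omega

section Quartic

variable {p : ℕ} [Fact p.Prime] {χ : MulChar (ZMod p) GaussianInt}

theorem pow_four_of_orderOf (hχ : orderOf χ = 4) {t : ZMod p} (ht : t ≠ 0) : χ t ^ 4 = 1 := by
  rw [← MulChar.pow_apply' _ (by norm_num), ← hχ, pow_orderOf_eq_one, MulChar.one_apply ht.isUnit]

theorem four_dvd_of_orderOf (hχ : orderOf χ = 4) : 4 ∣ p - 1 := by
  have := χ.orderOf_dvd_card_sub_one
  rwa [hχ, ZMod.card] at this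

theorem ne_two_of_orderOf (hχ : orderOf χ = 4) : p ≠ 2 := by
  rintro rfl
  have := four_dvd_of_orderOf hχ
  omega

theorem sq_eq_quadraticChar (hχ : orderOf χ = 4) :
    χ ^ 2 = (quadraticChar (ZMod p)).ringHomComp (Int.castRingHom GaussianInt) :=
  MulChar.eq_quadraticChar_of_sq_eq_one (sq_ne_one_of_orderOf hχ)
    (by rw [← pow_mul, ← pow_orderOf_eq_one χ, hχ])

theorem sq_apply_eq_quadraticChar (hχ : orderOf χ = 4) (t : ZMod p) :
    χ t ^ 2 = (quadraticChar (ZMod p) t : GaussianInt) := by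
  rw [← MulChar.pow_apply' _ two_ne_zero, sq_eq_quadraticChar hχ]
  rfl

theorem star_jacobiSum (hχ : orderOf χ = 4) :
    jacobiSum (χ * χ ^ 2) (χ ^ 2) = star (jacobiSum χ (χ ^ 2)) := by
  unfold jacobiSum
  rw [star_sum]
  refine Finset.sum_congr rfl fun t _ => ?_
  rw [star_mul', ← pow_succ']
  congr 1
  · rw [MulChar.pow_apply' _ (by norm_num)]
    rcases eq_or_ne t 0 with rfl | ht
    · simp [MulChar.map_zero]
    · exact (star_eq_pow_three (pow_four_of_orderOf hχ ht)).symm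
  · rw [MulChar.pow_apply' _ two_ne_zero, sq_apply_eq_quadraticChar hχ, star_intCast]

/-- Summing over `x` a function of `x²` amounts to weighting `u` by `1 + (u | p)`. -/
theorem sum_comp_sq {F R : Type*} [Field F] [Fintype F] [DecidableEq F] [CommRing R]
    (hF : ringChar F ≠ 2) (g : F → R) :
    ∑ x : F, g (x ^ 2) = ∑ u : F, (1 + (quadraticChar F u : R)) * g u := by
  classical
  rw [← Finset.sum_fiberwise_of_maps_to (g := fun x : F => x ^ 2) (t := Finset.univ) (by simp)]
  refine Finset.sum_congr rfl fun u _ => ?_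
  rw [Finset.sum_congr rfl (g := fun _ => g u)
    (fun x hx => by rw [(Finset.mem_filter.mp hx).2]), Finset.sum_const, nsmul_eq_mul]
  congr 1
  have := quadraticChar_card_sqrts hF u
  rw [Set.toFinset_ofPred] at this
  have h2 := congrArg (Int.cast : ℤ → R) this
  push_cast at h2
  rw [h2, add_comm]

/-- The Legendre symbol sum attached to `y² = x³ + D x` in terms of a Jacobi sum. -/
theorem sum_quadraticChar_cubic (hχ : orderOf χ = 4) {D : ZMod p} (hD : D ≠ 0) :
    ((∑ x : ZMod p, quadraticChar (ZMod p) (x ^ 3 + D * x) : ℤ) : GaussianInt)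
      = χ (-1) * (star (χ D) * jacobiSum χ (χ ^ 2) + χ D * star (jacobiSum χ (χ ^ 2))) := by
  have hchar : ringChar (ZMod p) ≠ 2 := by
    rw [ZMod.ringChar_zmod_n]; exact ne_two_of_orderOf hχ
  have h2 := sq_apply_eq_quadraticChar hχ
  have key : ∀ ψ : MulChar (ZMod p) GaussianInt,
      ∑ u : ZMod p, ψ u * (χ ^ 2) (u + D) = ψ (-1) * ψ D * χ D ^ 2 * jacobiSum ψ (χ ^ 2) := by
    intro ψ
    unfold jacobiSum
    rw [← Equiv.sum_comp (Equiv.mulLeft₀ (-D) (neg_ne_zero.mpr hD)), Finset.mul_sum]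
    refine Finset.sum_congr rfl fun v _ => ?_
    simp only [Equiv.mulLeft₀_apply]
    rw [show -D * v + D = D * (1 - v) by ring, show -D * v = -1 * D * v by ring, map_mul, map_mul,
      map_mul, MulChar.pow_apply' χ two_ne_zero D]
    ring
  have h1 : ((∑ x : ZMod p, quadraticChar (ZMod p) (x ^ 3 + D * x) : ℤ) : GaussianInt)
      = ∑ x : ZMod p, χ (x ^ 2) * (χ ^ 2) (x ^ 2 + D) := by
    push_cast
    refine Finset.sum_congr rfl fun x _ => ?_
    rw [show x ^ 3 + D * x = x * (x ^ 2 + D) by ring, map_mul, Int.cast_mul, ← h2, ← h2, map_pow,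
      MulChar.pow_apply' _ two_ne_zero]
  rw [h1, sum_comp_sq hchar (fun u => χ u * (χ ^ 2) (u + D))]
  have h3 : ∀ u : ZMod p, (1 + ((quadraticChar (ZMod p) u : ℤ) : GaussianInt)) *
      (χ u * (χ ^ 2) (u + D)) = χ u * (χ ^ 2) (u + D) + (χ * χ ^ 2) u * (χ ^ 2) (u + D) := by
    intro u
    rw [← h2, MulChar.mul_apply, MulChar.pow_apply' χ two_ne_zero u]
    ring
  simp_rw [h3]
  rw [Finset.sum_add_distrib, key, key, star_jacobiSum hχ]
  have hm1 : χ (-1) ^ 2 = 1 := by rw [← map_pow]; simp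
  have hD4 := pow_four_of_orderOf hχ hD
  rw [star_eq_pow_three hD4, MulChar.mul_apply, MulChar.mul_apply, MulChar.pow_apply' _ two_ne_zero,
    MulChar.pow_apply' _ two_ne_zero, hm1]
  linear_combination χ (-1) * star (jacobiSum χ (χ ^ 2)) * χ D * hD4

theorem jacobiSum_mul_star (hχ : orderOf χ = 4) :
    jacobiSum χ (χ ^ 2) * star (jacobiSum χ (χ ^ 2)) = p := by
  have hinj : Function.Injective GaussianInt.toComplex := by
    intro x y h
    exact GaussianInt.toComplex_inj.mp h
  apply hinj
  have hcp : ringChar ℂ ≠ ringChar (ZMod p) := by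
    rw [ZMod.ringChar_zmod_n, ringChar.eq_zero]
    exact (Fact.out : p.Prime).ne_zero.symm
  have h := jacobiSum_mul_jacobiSum_inv hcp (χ := χ.ringHomComp GaussianInt.toComplex)
    (φ := (χ ^ 2).ringHomComp GaussianInt.toComplex)
    ((MulChar.ringHomComp_ne_one_iff hinj).mpr (ne_one_of_orderOf hχ))
    ((MulChar.ringHomComp_ne_one_iff hinj).mpr (sq_ne_one_of_orderOf hχ))
    (by rw [← MulChar.ringHomComp_mul]
        exact (MulChar.ringHomComp_ne_one_iff hinj).mpr (cube_ne_one_of_orderOf hχ))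
  have h4 : χ ^ 4 = 1 := by rw [← hχ, pow_orderOf_eq_one]
  have hi1 : χ⁻¹ = χ * χ ^ 2 := inv_eq_of_mul_eq_one_right (by rw [← pow_succ', ← pow_succ', h4])
  have hi2 : (χ ^ 2)⁻¹ = χ ^ 2 := inv_eq_of_mul_eq_one_right (by rw [← pow_add, h4])
  rw [MulChar.ringHomComp_inv, MulChar.ringHomComp_inv, hi1, hi2, jacobiSum_ringHomComp,
    jacobiSum_ringHomComp, star_jacobiSum hχ, ZMod.card] at h
  rw [map_mul, h, map_natCast]

/-- `J(χ, χ²) ≡ -p` modulo `2 + 2i`, since `(1 - χ(t)) (1 - χ²(1 - t))` is divisible by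
`2 (1 - i)`. -/
theorem two_add_two_I_dvd_jacobiSum (hχ : orderOf χ = 4) :
    (⟨2, 2⟩ : GaussianInt) ∣ jacobiSum χ (χ ^ 2) + p := by
  have h1 := MulChar.sum_eq_zero_of_ne_one (ne_one_of_orderOf hχ)
  have h2 := MulChar.sum_eq_zero_of_ne_one (sq_ne_one_of_orderOf hχ)
  have h3 : ∑ t : ZMod p, (χ ^ 2) (1 - t) = 0 := by
    rw [← h2]; exact Equiv.sum_comp (Equiv.subLeft (1 : ZMod p)) fun t => (χ ^ 2) t
  have h4 : jacobiSum χ (χ ^ 2) + p = ∑ t : ZMod p, (χ t - 1) * ((χ ^ 2) (1 - t) - 1) := by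
    have : ∀ t : ZMod p, (χ t - 1) * ((χ ^ 2) (1 - t) - 1)
        = χ t * (χ ^ 2) (1 - t) - χ t - (χ ^ 2) (1 - t) + 1 := fun t => by ring
    simp_rw [this]
    rw [Finset.sum_add_distrib, Finset.sum_sub_distrib, Finset.sum_sub_distrib, h1, h3]
    simp [jacobiSum]
  rw [h4, Finset.sum_eq_sum_sdiff_singleton_add (Finset.mem_univ (0 : ZMod p))]
  simp only [sub_zero, map_one, sub_self, mul_zero, add_zero]
  refine Finset.dvd_sum fun t ht => ?_
  have ht0 : t ≠ 0 := by simpa using ht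
  rcases eq_or_ne t 1 with rfl | ht1
  · simp
  have hs : 1 - t ≠ 0 := sub_ne_zero.mpr ht1.symm
  have hs2 : (χ ^ 2) (1 - t) = 1 ∨ (χ ^ 2) (1 - t) = -1 := by
    rw [MulChar.pow_apply' _ two_ne_zero]
    exact eq_or_eq_neg_of_sq_eq_sq _ _ (by rw [← pow_mul, one_pow, pow_four_of_orderOf hχ hs])
  rcases hs2 with hs2 | hs2 <;> rw [hs2]
  · simp
  rcases eq_of_pow_four_eq_one (pow_four_of_orderOf hχ ht0) with h | h | h | h <;> rw [h]
  · simp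
  · exact ⟨⟨1, -1⟩, by decide⟩
  · exact ⟨⟨0, -1⟩, by decide⟩
  · exact ⟨1, by decide⟩

theorem jacobiSum_re_sq_add_im_sq (hχ : orderOf χ = 4) :
    (jacobiSum χ (χ ^ 2)).re ^ 2 + (jacobiSum χ (χ ^ 2)).im ^ 2 = p := by
  have h := congrArg Zsqrtd.re (jacobiSum_mul_star hχ)
  simp only [Zsqrtd.re_mul, Zsqrtd.re_star, Zsqrtd.im_star, Zsqrtd.re_natCast] at h
  linarith

theorem jacobiSum_re_im_mod_four (hχ : orderOf χ = 4) :
    Even (jacobiSum χ (χ ^ 2)).im ∧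
      (jacobiSum χ (χ ^ 2)).re ≡ (jacobiSum χ (χ ^ 2)).im - 1 [ZMOD 4] := by
  obtain ⟨c, hc⟩ := two_add_two_I_dvd_jacobiSum hχ
  have hre := congrArg Zsqrtd.re hc
  have him := congrArg Zsqrtd.im hc
  simp only [Zsqrtd.re_add, Zsqrtd.im_add, Zsqrtd.re_mul, Zsqrtd.im_mul, Zsqrtd.re_natCast,
    Zsqrtd.im_natCast] at hre him
  have h4 := four_dvd_of_orderOf hχ
  have hp := (Fact.out : p.Prime).one_lt
  refine ⟨⟨c.im + c.re, by linarith⟩, ?_⟩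
  unfold Int.ModEq
  omega

theorem orderOf_inv_and_jacobiSum (hχ : orderOf χ = 4) :
    orderOf χ⁻¹ = 4 ∧ jacobiSum χ⁻¹ (χ⁻¹ ^ 2) = star (jacobiSum χ (χ ^ 2)) := by
  have h4 : χ ^ 4 = 1 := by rw [← hχ, pow_orderOf_eq_one]
  have hi1 : χ⁻¹ = χ * χ ^ 2 := inv_eq_of_mul_eq_one_right (by rw [← pow_succ', ← pow_succ', h4])
  have hi2 : (χ ^ 2)⁻¹ = χ ^ 2 := inv_eq_of_mul_eq_one_right (by rw [← pow_add, h4])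
  refine ⟨by rw [orderOf_inv, hχ], ?_⟩
  rw [inv_pow, hi2, hi1, star_jacobiSum hχ]

end Quartic

/-- A prime has at most one representation as a sum of an odd and an even square. -/
theorem Int.sq_eq_sq_of_prime_sq_add_sq {p : ℕ} (hp : p.Prime) {a b x y : ℤ}
    (h1 : a ^ 2 + b ^ 2 = p) (h2 : x ^ 2 + y ^ 2 = p) (hb : Even b) (hy : Even y) (hx : Odd x) :
    a ^ 2 = x ^ 2 ∧ b ^ 2 = y ^ 2 := by
  have hp0 : (p : ℤ) ≠ 0 := by exact_mod_cast hp.ne_zero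
  have ha : Odd a := by
    have : Odd (a ^ 2 + b ^ 2) := by
      rw [h1, ← h2]
      exact (hx.pow).add_even (hy.pow_of_ne_zero two_ne_zero)
    rw [Int.odd_add] at this
    by_contra hne
    rw [Int.not_odd_iff_even] at hne
    have := this.mpr (hb.pow_of_ne_zero two_ne_zero)
    rw [Int.odd_pow' two_ne_zero] at this
    exact (Int.not_odd_iff_even.mpr hne) this
  have key : (a * y - b * x) * (a * y + b * x) = p * (y ^ 2 - b ^ 2) := by
    linear_combination y ^ 2 * h1 - b ^ 2 * h2
  suffices h : (a * y - b * x) * (a * y + b * x) = 0 by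
    rw [h] at key
    have hby : y ^ 2 - b ^ 2 = 0 := by
      rcases mul_eq_zero.mp key.symm with h | h
      · exact absurd h hp0
      · exact h
    constructor <;> linarith
  have aux : ∀ b : ℤ, Even b → a ^ 2 + b ^ 2 = p → (p : ℤ) ∣ a * y - b * x → a * y - b * x = 0 := by
    rintro b hb h1 ⟨k, hk⟩
    have hid : (a * y - b * x) ^ 2 + (a * x + b * y) ^ 2 = (p : ℤ) ^ 2 := by
      linear_combination (x ^ 2 + y ^ 2) * h1 + p * h2
    have hodd : Odd (a * x + b * y) := (ha.mul hx).add_even (hb.mul_right y)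
    have hne : a * x + b * y ≠ 0 := fun h => by rw [h] at hodd; exact absurd hodd (by decide)
    have hpos : 0 < (a * x + b * y) ^ 2 := by positivity
    rw [hk] at hid ⊢
    have hk1 : k ^ 2 < 1 := by
      have hpp : 0 < (p : ℤ) ^ 2 := by positivity
      nlinarith
    have hk0 : k = 0 := by
      by_contra h
      have : 0 < k ^ 2 := by positivity
      omega
    rw [hk0, mul_zero]
  have hpi : Prime (p : ℤ) := Nat.prime_iff_prime_int.mp hp
  rcases hpi.dvd_or_dvd ⟨_, key⟩ with h | h
  · rw [aux b hb h1 h, zero_mul]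
  · have := aux (-b) hb.neg (by rw [neg_sq, h1]) (by rwa [neg_mul, sub_neg_eq_add])
    rw [neg_mul, sub_neg_eq_add] at this
    rw [this, mul_zero]

/-- The congruence modulo `2 + 2i` and the norm determine `J(χ, χ²)` up to conjugation, that is, up to
replacing `χ` by its inverse. -/
theorem exists_quartic_jacobiSum_eq {p : ℕ} [Fact p.Prime] {x y : ℤ} (h : x ^ 2 + y ^ 2 = p)
    (hy : Even y) (hxy : x ≡ y - 1 [ZMOD 4]) :
    ∃ χ : MulChar (ZMod p) GaussianInt, orderOf χ = 4 ∧ jacobiSum χ (χ ^ 2) = ⟨x, y⟩ := by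
  have hx : Odd x := by
    rcases hy with ⟨k, rfl⟩
    rw [Int.odd_iff]
    unfold Int.ModEq at hxy
    omega
  have h4 : 4 ∣ Fintype.card (ZMod p) - 1 := by
    rw [ZMod.card]
    obtain ⟨k, rfl⟩ := hy
    obtain ⟨m, rfl⟩ := hx
    have : (p : ℤ) = 4 * (m ^ 2 + m + k ^ 2) + 1 := by rw [← h]; ring
    have hp := (Fact.out : p.Prime).one_lt
    generalize m ^ 2 + m + k ^ 2 = z at this
    omega
  obtain ⟨χ, hχ⟩ := MulChar.exists_mulChar_orderOf (ZMod p) h4 isPrimitiveRoot_I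
  obtain ⟨hev, hmod⟩ := jacobiSum_re_im_mod_four hχ
  have hsq := jacobiSum_re_sq_add_im_sq hχ
  obtain ⟨hinvord, hinv⟩ := orderOf_inv_and_jacobiSum hχ
  obtain ⟨e1, e2⟩ := Int.sq_eq_sq_of_prime_sq_add_sq Fact.out hsq h hev hy hx
  set J := jacobiSum χ (χ ^ 2) with hJ
  have hre : J.re = x := by
    rcases sq_eq_sq_iff_eq_or_eq_neg.mp e1 with h | h
    · exact h
    · exfalso
      unfold Int.ModEq at hmod hxy
      rw [Int.odd_iff] at hx
      rcases hy with ⟨k, rfl⟩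
      rcases sq_eq_sq_iff_eq_or_eq_neg.mp e2 with h' | h' <;> omega
  rcases sq_eq_sq_iff_eq_or_eq_neg.mp e2 with him | him
  · exact ⟨χ, hχ, Zsqrtd.ext hre him⟩
  · exact ⟨χ⁻¹, hinvord, by rw [hinv]; exact Zsqrtd.ext hre (by simp [him])⟩

/-! ### Rational quartic reciprocity from Gauss sums in characteristic `l` -/

section GaussSum

variable {p : ℕ} [Fact p.Prime] {K : Type*} [Field K] {χ : MulChar (ZMod p) K}
  {ψ : AddChar (ZMod p) K}

theorem gaussSum_mul_gaussSum_cube (hχ : orderOf χ = 4) (hψ : ψ.IsPrimitive) :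
    gaussSum χ ψ * gaussSum (χ ^ 3) ψ = χ (-1) * p := by
  have := gaussSum_mul_gaussSum_pow_orderOf_sub_one (ne_one_of_orderOf hχ) hψ
  rwa [hχ, ZMod.card] at this

/-- The fourth power of a quartic Gauss sum is `J(χ, χ²)² p`. -/
theorem gaussSum_pow_four (hχ : orderOf χ = 4) (hψ : ψ.IsPrimitive) (hp : (p : K) ≠ 0) :
    gaussSum χ ψ ^ 4 = jacobiSum χ (χ ^ 2) ^ 2 * p := by
  have h4 : χ ^ 4 = 1 := by rw [← hχ, pow_orderOf_eq_one]
  have hm1 : χ (-1) ^ 2 = 1 := by rw [← map_pow]; simp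
  have h1 := jacobiSum_mul_nontrivial (cube_ne_one_of_orderOf hχ) ψ
  rw [← pow_succ'] at h1
  have h2 := gaussSum_mul_gaussSum_cube hχ hψ
  have h3 : gaussSum (χ ^ 2) ψ ^ 2 = p := by
    have hinv : (χ ^ 2)⁻¹ = χ ^ 2 := inv_eq_of_mul_eq_one_right (by rw [← pow_add, h4])
    have h := gaussSum_mul_gaussSum_pow_orderOf_sub_one (sq_ne_one_of_orderOf hχ) hψ
    have ho : orderOf (χ ^ 2) = 2 :=
      orderOf_eq_prime (by rw [← pow_mul, h4]) (sq_ne_one_of_orderOf hχ)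
    rw [ho, ZMod.card, MulChar.pow_apply' _ two_ne_zero, hm1, one_mul] at h
    rw [← h, pow_one, sq]
  apply mul_right_cancel₀ hp
  calc gaussSum χ ψ ^ 4 * p = (gaussSum χ ψ * (gaussSum χ ψ * gaussSum (χ ^ 2) ψ)) ^ 2 := by
        rw [← h3]; ring
    _ = (gaussSum χ ψ * gaussSum (χ ^ 3) ψ * jacobiSum χ (χ ^ 2)) ^ 2 := by rw [← h1]; ring
    _ = _ := by rw [h2]; linear_combination (p : K) ^ 2 * jacobiSum χ (χ ^ 2) ^ 2 * hm1

variable {l : ℕ} [Fact l.Prime] [CharP K l]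

/-- The Frobenius map sends the Gauss sum of `χ` to `χ(l)⁻¹` times itself when `l ≡ 1` modulo `4`. -/
theorem quartic_reciprocity_one_mod_four (hχ : orderOf χ = 4) (hψ : ψ.IsPrimitive)
    (hp : (p : K) ≠ 0) (hl : (l : ZMod p) ≠ 0) {m : ℕ} (hlm : l = 4 * m + 1) :
    χ l * (jacobiSum χ (χ ^ 2) ^ 2 * p) ^ m = 1 := by
  have hG : gaussSum χ ψ ≠ 0 :=
    gaussSum_ne_zero_of_nontrivial (by rwa [ZMod.card]) (ne_one_of_orderOf hχ) hψ
  have h4 : χ ^ 4 = 1 := by rw [← hχ, pow_orderOf_eq_one]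
  have hfrob := gaussSum_frob l χ ψ
  have hχl : χ ^ l = χ := by rw [hlm, pow_succ, pow_mul, h4, one_pow, one_mul]
  have hsh := gaussSum_mulShift χ ψ (Units.mk0 _ hl)
  rw [Units.val_mk0] at hsh
  rw [hχl, AddChar.pow_mulShift] at hfrob
  rw [← hfrob] at hsh
  rw [← gaussSum_pow_four hχ hψ hp]
  apply mul_right_cancel₀ hG
  calc χ l * (gaussSum χ ψ ^ 4) ^ m * gaussSum χ ψ
      = χ l * gaussSum χ ψ ^ (4 * m + 1) := by ring
    _ = 1 * gaussSum χ ψ := by rw [← hlm, hsh, one_mul]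

/-- When `l ≡ 3` modulo `4`, the Frobenius map sends the Gauss sum of `χ` to a multiple of that of
`χ³ = χ⁻¹`, and the product of the two is `χ(-1) p`. -/
theorem quartic_reciprocity_three_mod_four (hχ : orderOf χ = 4) (hψ : ψ.IsPrimitive)
    (hp : (p : K) ≠ 0) (hl : (l : ZMod p) ≠ 0) {m : ℕ} (hlm : l + 1 = 4 * m) :
    (jacobiSum χ (χ ^ 2) ^ 2 * p) ^ m = χ l * χ (-1) * p := by
  have h4 : χ ^ 4 = 1 := by rw [← hχ, pow_orderOf_eq_one]
  have hfrob := gaussSum_frob l χ ψ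
  have hχl : χ ^ l = χ ^ 3 := by
    have : l = 4 * (m - 1) + 3 := by omega
    rw [this, pow_add, pow_mul, h4, one_pow, one_mul]
  have hsh := gaussSum_mulShift (χ ^ 3) ψ (Units.mk0 _ hl)
  rw [Units.val_mk0] at hsh
  rw [hχl, AddChar.pow_mulShift] at hfrob
  rw [← hfrob, MulChar.pow_apply' _ (by norm_num)] at hsh
  have hl4 : χ l ^ 4 = 1 := by
    rw [← MulChar.pow_apply' _ (by norm_num), h4, MulChar.one_apply hl.isUnit]
  rw [← gaussSum_pow_four hχ hψ hp, ← pow_mul, ← hlm, mul_assoc,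
    ← gaussSum_mul_gaussSum_cube hχ hψ, ← hsh]
  linear_combination -gaussSum χ ψ ^ (l + 1) * hl4

end GaussSum

theorem orderOf_ringHomComp {p : ℕ} [Fact p.Prime] {χ : MulChar (ZMod p) GaussianInt}
    (hχ : orderOf χ = 4) {K : Type*} [Field K] (h2 : (2 : K) ≠ 0) (ι : GaussianInt →+* K) :
    orderOf (χ.ringHomComp ι) = 4 := by
  refine orderOf_eq_prime_pow (p := 2) (n := 1) ?_ ?_
  · obtain ⟨a, ha⟩ := MulChar.ne_one_iff.mp (sq_ne_one_of_orderOf hχ)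
    intro h
    have h1 : ((χ.ringHomComp ι) ^ 2 ^ 1) (a : ZMod p) = 1 := by
      rw [h, MulChar.one_apply_coe]
    rw [MulChar.pow_apply' _ (by norm_num), MulChar.ringHomComp_apply, ← map_pow] at h1
    have h4 := pow_four_of_orderOf hχ a.ne_zero
    rw [MulChar.pow_apply' _ two_ne_zero] at ha
    have : χ (a : ZMod p) ^ 2 = -1 :=
      (eq_or_eq_neg_of_sq_eq_sq _ _ (by rw [← pow_mul, one_pow, h4])).resolve_left ha
    rw [pow_one, this, map_neg, map_one] at h1
    exact h2 (by linear_combination -h1)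
  · rw [show 2 ^ (1 + 1) = 4 by norm_num, MulChar.ringHomComp_pow, ← hχ, pow_orderOf_eq_one,
      MulChar.ringHomComp_one]

theorem GaussianInt.eq_one_of_map_eq_one {K : Type*} [Field K] (h2 : (2 : K) ≠ 0)
    (ι : GaussianInt →+* K) {z : GaussianInt} (hz : z ^ 4 = 1) (h : ι z = 1) : z = 1 := by
  have hI : ι I ^ 2 = -1 := by rw [← map_pow, I_sq, map_neg, map_one]
  rcases eq_of_pow_four_eq_one hz with rfl | rfl | rfl | rfl
  · rfl
  · rw [map_neg, map_one] at h
    exact absurd (by linear_combination -h) h2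
  · rw [h] at hI
    exact absurd (by linear_combination hI) h2
  · rw [map_neg] at h
    exact absurd (by linear_combination hI - (1 - ι I) * h) h2

/-- In characteristic `l` the values at `l` of two normalised quartic characters are linked to the
residues modulo `l` of their Jacobi sums `x + y i` and `x' + y i`: they agree when `x ≡ x'`, and are
inverse to each other when `x ≡ -x'`. -/
theorem quarticChar_apply_prime {p p' l : ℕ} [Fact p.Prime] [Fact p'.Prime] [Fact l.Prime]
    {χ : MulChar (ZMod p) GaussianInt} {χ' : MulChar (ZMod p') GaussianInt} {x x' y : ℤ}
    (hχ : orderOf χ = 4) (hχ' : orderOf χ' = 4)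
    (hJ : jacobiSum χ (χ ^ 2) = ⟨x, y⟩) (hJ' : jacobiSum χ' (χ' ^ 2) = ⟨x', y⟩)
    (hl2 : l ≠ 2) (hlp : l ≠ p) (hlp' : l ≠ p') (hneg : χ (-1) = χ' (-1)) :
    (x ≡ x' [ZMOD l] → χ l * star (χ' l) = 1) ∧ (x ≡ -x' [ZMOD l] → χ l * χ' l = 1) := by
  let K := AlgebraicClosure (ZMod l)
  have : CharP K l := charP_of_injective_algebraMap (algebraMap (ZMod l) K).injective l
  have hlP : l.Prime := Fact.out
  have ne_zero : ∀ {q : ℕ}, q.Prime → l ≠ q → (q : K) ≠ 0 := fun hq hlq h => by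
    rw [CharP.cast_eq_zero_iff K l, Nat.prime_dvd_prime_iff_eq hlP hq] at h
    exact hlq h
  have h2 : (2 : K) ≠ 0 := by exact_mod_cast ne_zero Nat.prime_two hl2
  have hp : (p : K) ≠ 0 := ne_zero Fact.out hlp
  have hp' : (p' : K) ≠ 0 := ne_zero Fact.out hlp'
  have hz : ∀ {q : ℕ}, q.Prime → l ≠ q → (l : ZMod q) ≠ 0 := fun {q} hq hlq h => by
    rw [ZMod.natCast_eq_zero_iff, Nat.prime_dvd_prime_iff_eq hq hlP] at h
    exact hlq h.symm
  have hlz := hz (Fact.out : p.Prime) hlp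
  have hlz' := hz (Fact.out : p'.Prime) hlp'
  obtain ⟨i, hi⟩ := IsAlgClosed.exists_pow_nat_eq (-1 : K) (n := 2) (by norm_num)
  -- `ι` is injective on fourth roots of unity, so identities between them may be checked in `K`
  let ι : GaussianInt →+* K := Zsqrtd.lift ⟨i, by rw [← sq, hi]; simp⟩
  have hι : ∀ a b : ℤ, ι ⟨a, b⟩ = a + b * i := fun a b => rfl
  have prim : ∀ {q : ℕ} [Fact q.Prime], (q : K) ≠ 0 → ∃ ψ : AddChar (ZMod q) K, ψ.IsPrimitive := by
    intro q _ hq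
    have : NeZero (q : K) := ⟨hq⟩
    obtain ⟨ζ, hζ⟩ := HasEnoughRootsOfUnity.exists_primitiveRoot K q
    exact ⟨_, AddChar.zmodChar_primitive_of_primitive_root q hζ⟩
  obtain ⟨ψ, hψ⟩ := prim hp
  obtain ⟨ψ', hψ'⟩ := prim hp'
  have ho := orderOf_ringHomComp hχ h2 ι
  have ho' := orderOf_ringHomComp hχ' h2 ι
  have hj : jacobiSum (χ.ringHomComp ι) ((χ.ringHomComp ι) ^ 2) = x + y * i := by
    rw [MulChar.ringHomComp_pow, jacobiSum_ringHomComp, hJ, hι]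
  have hj' : jacobiSum (χ'.ringHomComp ι) ((χ'.ringHomComp ι) ^ 2) = x' + y * i := by
    rw [MulChar.ringHomComp_pow, jacobiSum_ringHomComp, hJ', hι]
  have hpK : (p : K) = x ^ 2 + y ^ 2 := by
    have := jacobiSum_re_sq_add_im_sq hχ
    rw [hJ] at this
    have := congrArg (Int.cast : ℤ → K) this
    push_cast at this
    exact this.symm
  have hpK' : (p' : K) = x' ^ 2 + y ^ 2 := by
    have := jacobiSum_re_sq_add_im_sq hχ'
    rw [hJ'] at this
    have := congrArg (Int.cast : ℤ → K) this
    push_cast at this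
    exact this.symm
  have hv4 := pow_four_of_orderOf hχ hlz
  have hv4' := pow_four_of_orderOf hχ' hlz'
  have hfrob : (p : K) ^ l = p := by
    have := map_natCast (frobenius K l) p
    rwa [frobenius_def] at this
  have hodd : l % 4 = 1 ∨ l % 4 = 3 := by
    have := hlP.eq_two_or_odd
    omega
  have hm1 : χ' (-1) ^ 2 = 1 := by rw [← map_pow]; simp
  have hm1K : ι (χ' (-1)) ^ 2 = 1 := by rw [← map_pow, hm1, map_one]
  rcases hodd with hmod | hmod
  · obtain ⟨m, hm⟩ : ∃ m, l = 4 * m + 1 := ⟨l / 4, by omega⟩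
    have e := quartic_reciprocity_one_mod_four ho hψ hp hlz hm
    have e' := quartic_reciprocity_one_mod_four ho' hψ' hp' hlz' hm
    rw [hj, MulChar.ringHomComp_apply] at e
    rw [hj', MulChar.ringHomComp_apply] at e'
    constructor
    · intro hxx
      have hK : (x : K) = x' := (CharP.intCast_eq_intCast K l).mpr hxx
      have hpp : (p : K) = p' := by rw [hpK, hpK', hK]
      have hz : (χ l * star (χ' l)) ^ 4 = 1 := by
        rw [mul_pow, hv4, one_mul, ← star_pow, hv4', star_one]
      refine eq_one_of_map_eq_one h2 ι hz ?_
      rw [← hK, ← hpp] at e'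
      have hne : ((x + y * i : K) ^ 2 * p) ^ m ≠ 0 := right_ne_zero_of_mul_eq_one e
      have hee : ι (χ l) = ι (χ' l) := mul_right_cancel₀ hne (e.trans e'.symm)
      rw [map_mul, hee, ← map_mul, mul_star_of_pow_four_eq_one hv4', map_one]
    · intro hxx
      have hK : (x : K) = -x' := by
        have := (CharP.intCast_eq_intCast K l).mpr hxx
        push_cast at this
        exact this
      have hpp : (p' : K) = p := by rw [hpK, hpK', hK]; ring
      refine eq_one_of_map_eq_one h2 ι (by rw [mul_pow, hv4, hv4', one_mul]) ?_
      have hprod : ((x + y * i : K) ^ 2 * p) ^ m * ((x' + y * i : K) ^ 2 * p') ^ m = 1 := by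
        rw [← mul_pow, hpp]
        have : (x + y * i : K) ^ 2 * p * ((x' + y * i : K) ^ 2 * p) = (p : K) ^ 4 := by
          have h3 : (x + y * i : K) * (x' + y * i) = -p := by
            rw [hpK, hK]; linear_combination (y : K) ^ 2 * hi
          calc (x + y * i : K) ^ 2 * p * ((x' + y * i : K) ^ 2 * p)
              = ((x + y * i : K) * (x' + y * i)) ^ 2 * (p : K) ^ 2 := by ring
            _ = _ := by rw [h3]; ring
        rw [this, ← pow_mul]
        apply mul_right_cancel₀ hp
        rw [← pow_succ, ← hm, hfrob, one_mul]
      rw [map_mul]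
      linear_combination
        ι (χ' l) * ((x' + y * i : K) ^ 2 * p') ^ m * e + e' - ι (χ l) * ι (χ' l) * hprod
  · obtain ⟨m, hm⟩ : ∃ m, l + 1 = 4 * m := ⟨(l + 1) / 4, by omega⟩
    have e := quartic_reciprocity_three_mod_four ho hψ hp hlz hm
    have e' := quartic_reciprocity_three_mod_four ho' hψ' hp' hlz' hm
    rw [hj, MulChar.ringHomComp_apply, MulChar.ringHomComp_apply, hneg] at e
    rw [hj', MulChar.ringHomComp_apply, MulChar.ringHomComp_apply] at e'
    have hs0 : ι (χ' (-1)) ≠ 0 := fun h => by rw [h] at hm1K; simp at hm1K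
    constructor
    · intro hxx
      have hK : (x : K) = x' := (CharP.intCast_eq_intCast K l).mpr hxx
      have hpp : (p : K) = p' := by rw [hpK, hpK', hK]
      have hz : (χ l * star (χ' l)) ^ 4 = 1 := by
        rw [mul_pow, hv4, one_mul, ← star_pow, hv4', star_one]
      refine eq_one_of_map_eq_one h2 ι hz ?_
      rw [← hK, ← hpp] at e'
      have hee : ι (χ l) = ι (χ' l) :=
        mul_right_cancel₀ hs0 (mul_right_cancel₀ hp (e.symm.trans e'))
      rw [map_mul, hee, ← map_mul, mul_star_of_pow_four_eq_one hv4', map_one]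
    · intro hxx
      have hK : (x : K) = -x' := by
        have := (CharP.intCast_eq_intCast K l).mpr hxx
        push_cast at this
        exact this
      have hpp : (p' : K) = p := by rw [hpK, hpK', hK]; ring
      refine eq_one_of_map_eq_one h2 ι (by rw [mul_pow, hv4, hv4', one_mul]) ?_
      have hprod : ((x + y * i : K) ^ 2 * p) ^ m * ((x' + y * i : K) ^ 2 * p') ^ m
          = (p : K) ^ 2 := by
        rw [← mul_pow, hpp]
        have : (x + y * i : K) ^ 2 * p * ((x' + y * i : K) ^ 2 * p) = (p : K) ^ 4 := by
          have h3 : (x + y * i : K) * (x' + y * i) = -p := by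
            rw [hpK, hK]; linear_combination (y : K) ^ 2 * hi
          calc (x + y * i : K) ^ 2 * p * ((x' + y * i : K) ^ 2 * p)
              = ((x + y * i : K) * (x' + y * i)) ^ 2 * (p : K) ^ 2 := by ring
            _ = _ := by rw [h3]; ring
        rw [this, ← pow_mul, ← hm, pow_succ, hfrob, sq]
      rw [e, e', hpp] at hprod
      rw [map_mul]
      apply mul_right_cancel₀ (pow_ne_zero 2 hp)
      linear_combination hprod - ι (χ l) * ι (χ' l) * (p : K) ^ 2 * hm1K

/-! ### The supplementary values and the trace of Frobenius -/

section Supplement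

variable {p : ℕ} [Fact p.Prime] {χ : MulChar (ZMod p) GaussianInt}

theorem quarticChar_neg_one (hχ : orderOf χ = 4) : χ (-1) = (-1) ^ ((p - 1) / 4) := by
  obtain ⟨k, hk⟩ := four_dvd_of_orderOf hχ
  have hpp : 1 < p := (Fact.out : p.Prime).one_lt
  have hp2 := ne_two_of_orderOf hχ
  have hchar : ringChar (ZMod p) ≠ 2 := by rwa [ZMod.ringChar_zmod_n]
  obtain ⟨j, hj⟩ : IsSquare (-1 : ZMod p) := by
    rw [FiniteField.isSquare_neg_one_iff, ZMod.card]; omega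
  have hq : quadraticChar (ZMod p) j = (-1) ^ k := by
    have h := quadraticChar_eq_pow_of_char_ne_two' hchar j
    have hj0 : j ≠ 0 := by rintro rfl; simp at hj
    rw [ZMod.card, show p / 2 = 2 * k by omega, pow_mul, sq, ← hj] at h
    have h1 : (-1 : ZMod p) ≠ 1 := Ring.neg_one_ne_one_of_char_ne_two hchar
    rcases Nat.even_or_odd k with hk' | hk' <;> rw [hk'.neg_one_pow] at h ⊢ <;>
      rcases quadraticChar_dichotomy hj0 with hd | hd <;> rw [hd] at h ⊢
    · exact absurd (by simpa using h) h1
    · exact absurd (by simpa using h.symm) h1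
  rw [hj, map_mul, ← sq, sq_apply_eq_quadraticChar hχ, hq, hk]
  simp

theorem quarticChar_four (hχ : orderOf χ = 4) : χ 4 = (ZMod.χ₈ p : GaussianInt) := by
  have hchar : ringChar (ZMod p) ≠ 2 := by
    rw [ZMod.ringChar_zmod_n]; exact ne_two_of_orderOf hχ
  rw [show (4 : ZMod p) = 2 ^ 2 by norm_num, map_pow, sq_apply_eq_quadraticChar hχ,
    quadraticChar_two hchar, ZMod.card]

/-- For the quartic character with `J(χ, χ²) = x + y i`, the trace of Frobenius is `± 2 y` according
as `χ(D) = ∓ χ(-1) i`. -/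
theorem frobTrace_eq_iff (hχ : orderOf χ = 4) {x y D : ℤ} (hJ : jacobiSum χ (χ ^ 2) = ⟨x, y⟩)
    (hx : Odd x) (hy : Even y) (hy0 : y ≠ 0) (hD : ¬ (p : ℤ) ∣ D) :
    (frobTrace D p = 2 * y ↔ χ D = -χ (-1) * I) ∧
      (frobTrace D p = 2 * -y ↔ χ D = χ (-1) * I) := by
  have hD0 : (D : ZMod p) ≠ 0 := by rwa [Ne, ZMod.intCast_zmod_eq_zero_iff_dvd]
  have h := sum_quadraticChar_cubic hχ hD0
  have ht := frobTrace_eq_neg_sum (ne_two_of_orderOf hχ) hD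
  have ht' : ((frobTrace D p : ℤ) : GaussianInt)
      = -(χ (-1) * (star (χ D) * ⟨x, y⟩ + χ D * star ⟨x, y⟩)) := by
    rw [ht, Int.cast_neg, h, hJ]
  have hre := congrArg Zsqrtd.re ht'
  have hm1 : χ (-1) = 1 ∨ χ (-1) = -1 := by
    rw [quarticChar_neg_one hχ]; exact neg_one_pow_eq_or _ _
  have e1 : (1 : GaussianInt) = ⟨1, 0⟩ := rfl
  have e2 : I = ⟨0, 1⟩ := rfl
  obtain ⟨k, hk⟩ := hx
  obtain ⟨m, hm⟩ := hy
  rcases hm1 with hs | hs <;>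
    rcases eq_of_pow_four_eq_one (pow_four_of_orderOf hχ hD0) with hv | hv | hv | hv <;>
    rw [hs, hv] at hre ⊢ <;>
    simp [e1, e2, Zsqrtd.ext_iff] at hre ⊢ <;> omega

theorem quadraticChar_eq_neg_one_iff (hχ : orderOf χ = 4) {D : ZMod p} (hD : D ≠ 0) :
    quadraticChar (ZMod p) D = -1 ↔ (χ D = -χ (-1) * I ∨ χ D = χ (-1) * I) := by
  have h := sq_apply_eq_quadraticChar hχ D
  have hm1 : χ (-1) = 1 ∨ χ (-1) = -1 := by
    rw [quarticChar_neg_one hχ]; exact neg_one_pow_eq_or _ _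
  have e1 : (1 : GaussianInt) = ⟨1, 0⟩ := rfl
  have e2 : I = ⟨0, 1⟩ := rfl
  rcases hm1 with hs | hs <;>
    rcases eq_of_pow_four_eq_one (pow_four_of_orderOf hχ hD) with hv | hv | hv | hv <;>
    rcases quadraticChar_dichotomy hD with hd | hd <;>
    rw [hv, hd] at h <;> rw [hs, hv, hd] <;>
    simp [e1, e2, Zsqrtd.ext_iff, sq] at h ⊢

end Supplement

/-! ### Dependence of the trace on residue classes -/

/-- The odd primes dividing `D`. -/
def oddPrimes (D : ℤ) : Finset ℕ :=
  D.natAbs.primeFactors.erase 2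

theorem mem_oddPrimes {D : ℤ} (hD : D ≠ 0) {l : ℕ} :
    l ∈ oddPrimes D ↔ l.Prime ∧ l ≠ 2 ∧ (l : ℤ) ∣ D := by
  simp [oddPrimes, hD, Int.natCast_dvd]
  tauto

theorem ne_zero_of_odd_or_four_dvd {D : ℤ} (hD : Odd D ∨ ((4 : ℤ) ∣ D ∧ ¬ (8 : ℤ) ∣ D)) :
    D ≠ 0 := by
  rintro rfl
  rcases hD with h | h
  · exact absurd h (by decide)
  · exact h.2 (dvd_zero _)

theorem factorization_two_of_odd_or_four_dvd {D : ℤ}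
    (hD : Odd D ∨ ((4 : ℤ) ∣ D ∧ ¬ (8 : ℤ) ∣ D)) :
    D.natAbs.factorization 2 = 0 ∨ D.natAbs.factorization 2 = 2 := by
  have h0 := ne_zero_of_odd_or_four_dvd hD
  rcases hD with h | ⟨h4, h8⟩
  · left
    apply Nat.factorization_eq_zero_of_not_dvd
    rw [← Int.natCast_dvd]
    rw [Int.odd_iff] at h
    omega
  · right
    have h0' := Int.natAbs_ne_zero.mpr h0
    apply le_antisymm
    · by_contra hlt
      push Not at hlt
      have := (Nat.prime_two.pow_dvd_iff_le_factorization h0').mpr (show 3 ≤ _ from hlt)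
      exact h8 (Int.natCast_dvd.mpr this)
    · exact (Nat.prime_two.pow_dvd_iff_le_factorization h0').mp (Int.natCast_dvd.mp h4)

/-- A multiplicative function trivial at `-1` and `4` is determined on odd integers, and on integers
exactly divisible by `4`, by the odd primes. -/
theorem map_eq_prod_oddPrimes {R : Type*} [CommMonoid R] (f : ℤ →* R) {D : ℤ}
    (hD : Odd D ∨ ((4 : ℤ) ∣ D ∧ ¬ (8 : ℤ) ∣ D)) (h1 : f (-1) = 1) (h4 : f 4 = 1) :
    f D = ∏ l ∈ oddPrimes D, f l ^ D.natAbs.factorization l := by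
  have h0 := ne_zero_of_odd_or_four_dvd hD
  have habs : f D = f (D.natAbs : ℤ) := by
    rcases Int.natAbs_eq D with h | h
    · rw [← h]
    · conv_lhs => rw [h]
      rw [← neg_one_mul, map_mul, h1, one_mul]
  have hprod : f (D.natAbs : ℤ) = ∏ l ∈ D.natAbs.primeFactors, f l ^ D.natAbs.factorization l := by
    conv_lhs => rw [← Nat.prod_factorization_pow_eq_self (Int.natAbs_ne_zero.mpr h0)]
    rw [Finsupp.prod, Nat.support_factorization]
    push_cast
    rw [map_prod]
    simp_rw [map_pow]
  rw [habs, hprod, oddPrimes]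
  by_cases h2 : 2 ∈ D.natAbs.primeFactors
  · rw [← Finset.mul_prod_erase _ _ h2]
    have : f ((2 : ℕ) : ℤ) ^ D.natAbs.factorization 2 = 1 := by
      rcases factorization_two_of_odd_or_four_dvd hD with h | h <;> rw [h]
      · exact pow_zero _
      · rw [← map_pow, ← h4]; rfl
    rw [this, one_mul]
  · rw [Finset.erase_eq_of_notMem h2]

theorem odd_of_prime_sq_add_sq {p : ℕ} (hp : p.Prime) {x y : ℤ} (h : x ^ 2 + y ^ 2 = p)
    (hy : Even y) : Odd x := by
  by_contra hx
  rw [Int.not_odd_iff_even] at hx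
  obtain ⟨a, rfl⟩ := hx
  obtain ⟨b, rfl⟩ := hy
  have h4 : (4 : ℤ) ∣ p := ⟨a ^ 2 + b ^ 2, by rw [← h]; ring⟩
  have h4' : 4 ∣ p := by exact_mod_cast h4
  have := (Nat.prime_dvd_prime_iff_eq Nat.prime_two hp).mp (dvd_trans (by norm_num) h4')
  subst this
  omega

/-- When `x ≡ x'` modulo `4`, the traces at `p = x² + y²` and `p' = x'² + y²` are simultaneously
`2 y` (or `-2 y`) if also `x ≡ x'` modulo every odd prime factor of `D`, whereas `2 y` and `-2 y` are
exchanged if `x ≡ -x'` modulo every odd prime factor of `D`. -/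
theorem frobTrace_eq_iff_of_modEq {p p' : ℕ} (hp : p.Prime) (hp' : p'.Prime) {x x' y D : ℤ}
    (h : x ^ 2 + y ^ 2 = p) (h' : x' ^ 2 + y ^ 2 = p') (hy : Even y) (hy0 : y ≠ 0)
    (hD : Odd D ∨ ((4 : ℤ) ∣ D ∧ ¬ (8 : ℤ) ∣ D))
    (hpD : ¬ (p : ℤ) ∣ D) (hpD' : ¬ (p' : ℤ) ∣ D) (h4 : x ≡ x' [ZMOD 4]) :
    ((∀ l ∈ oddPrimes D, x ≡ x' [ZMOD l]) →
      (frobTrace D p = 2 * y ↔ frobTrace D p' = 2 * y) ∧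
      (frobTrace D p = 2 * -y ↔ frobTrace D p' = 2 * -y)) ∧
    ((∀ l ∈ oddPrimes D, x ≡ -x' [ZMOD l]) →
      (frobTrace D p = 2 * y ↔ frobTrace D p' = 2 * -y) ∧
      (frobTrace D p = 2 * -y ↔ frobTrace D p' = 2 * y)) := by
  have hx := odd_of_prime_sq_add_sq hp h hy
  -- the normalisation `x ≡ y - 1` modulo `4` can be reached by changing the signs of `x` and `x'`
  wlog hn : x ≡ y - 1 [ZMOD 4] generalizing x x'
  · have key := this (x := -x) (x' := -x') (by rw [neg_sq, h]) (by rw [neg_sq, h']) h4.neg hx.neg (by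
      unfold Int.ModEq at hn ⊢
      rw [Int.odd_iff] at hx
      obtain ⟨k, rfl⟩ := hy
      omega)
    exact ⟨fun hl => key.1 fun l hl' => (hl l hl').neg, fun hl => key.2 fun l hl' => (hl l hl').neg⟩
  have hx' := odd_of_prime_sq_add_sq hp' h' hy
  have := Fact.mk hp
  have := Fact.mk hp'
  obtain ⟨χ, hχ, hJ⟩ := exists_quartic_jacobiSum_eq h hy hn
  obtain ⟨χ', hχ', hJ'⟩ := exists_quartic_jacobiSum_eq h' hy (h4.symm.trans hn)
  have h0 := ne_zero_of_odd_or_four_dvd hD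
  have hmod8 : p % 8 = p' % 8 := by
    have e1 := Int.eight_dvd_sq_sub_one_of_odd hx
    have e2 := Int.eight_dvd_sq_sub_one_of_odd hx'
    omega
  have hneg : χ (-1) = χ' (-1) := by
    rw [quarticChar_neg_one hχ, quarticChar_neg_one hχ', neg_one_pow_eq_pow_mod_two,
      neg_one_pow_eq_pow_mod_two (n := (p' - 1) / 4)]
    have a1 := four_dvd_of_orderOf hχ
    have a2 := four_dvd_of_orderOf hχ'
    have := hp.one_lt
    have := hp'.one_lt
    congr 1
    omega
  have hfour : χ 4 = χ' 4 := by
    rw [quarticChar_four hχ, quarticChar_four hχ']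
    have : (p : ZMod 8) = p' := (ZMod.natCast_eq_natCast_iff' _ _ _).mpr hmod8
    rw [this]
  have hm1 : χ' (-1) ^ 2 = 1 := by rw [← map_pow]; simp
  have hm1' : star (χ' (-1)) = χ' (-1) := by
    rcases eq_or_eq_neg_of_sq_eq_sq _ _ (hm1.trans (one_pow 2).symm) with e | e <;> rw [e] <;> simp
  have h4sq : χ' 4 ^ 2 = 1 := by
    have hchar : ringChar (ZMod p') ≠ 2 := by
      rw [ZMod.ringChar_zmod_n]; exact ne_two_of_orderOf hχ'
    have e : (4 : ZMod p') ^ 2 = 2 ^ 4 := by norm_num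
    rw [← map_pow, e, map_pow, pow_four_of_orderOf hχ' (Ring.two_ne_zero hchar)]
  have h4' : star (χ' 4) = χ' 4 := by
    rcases eq_or_eq_neg_of_sq_eq_sq _ _ (h4sq.trans (one_pow 2).symm) with e | e <;> rw [e] <;> simp
  have hDp' : (D : ZMod p') ≠ 0 := by rwa [Ne, ZMod.intCast_zmod_eq_zero_iff_dvd]
  have hv4' := pow_four_of_orderOf hχ' hDp'
  obtain ⟨t1, t2⟩ := frobTrace_eq_iff hχ hJ hx hy hy0 hpD
  obtain ⟨t1', t2'⟩ := frobTrace_eq_iff hχ' hJ' hx' hy hy0 hpD'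
  have hlocal : ∀ l ∈ oddPrimes D,
      (x ≡ x' [ZMOD l] → χ l * star (χ' l) = 1) ∧ (x ≡ -x' [ZMOD l] → χ l * χ' l = 1) := by
    intro l hl
    obtain ⟨hl1, hl2, hl3⟩ := (mem_oddPrimes h0).mp hl
    have := Fact.mk hl1
    exact quarticChar_apply_prime hχ hχ' hJ hJ' hl2 (by rintro rfl; exact hpD hl3)
      (by rintro rfl; exact hpD' hl3) hneg
  constructor
  · intro hl
    let f : ℤ →* GaussianInt :=
      { toFun := fun n => χ n * star (χ' n)
        map_one' := by simp
        map_mul' := fun a b => by push_cast; rw [map_mul, map_mul, star_mul']; ring }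
    have hf : f D = 1 := by
      rw [map_eq_prod_oddPrimes f hD]
      · exact Finset.prod_eq_one fun l hl' => by
          have : f l = 1 := by
            have := (hlocal l hl').1 (hl l hl')
            simpa [f] using this
          rw [this, one_pow]
      · have : f (-1) = χ (-1) * star (χ' (-1)) := by simp [f]
        rw [this, hneg, hm1', ← sq, hm1]
      · have : f 4 = χ 4 * star (χ' 4) := by simp [f]
        rw [this, hfour, h4', ← sq, h4sq]
    have hf' : χ D * star (χ' D) = 1 := hf
    have heq : χ D = χ' D := by
      linear_combination χ' D * hf' - χ D * mul_star_of_pow_four_eq_one hv4'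
    rw [t1, t2, t1', t2', heq, hneg]
    exact ⟨Iff.rfl, Iff.rfl⟩
  · intro hl
    let f : ℤ →* GaussianInt :=
      { toFun := fun n => χ n * χ' n
        map_one' := by simp
        map_mul' := fun a b => by push_cast; rw [map_mul, map_mul]; ring }
    have hf : f D = 1 := by
      rw [map_eq_prod_oddPrimes f hD]
      · exact Finset.prod_eq_one fun l hl' => by
          have : f l = 1 := by
            have := (hlocal l hl').2 (hl l hl')
            simpa [f] using this
          rw [this, one_pow]
      · have : f (-1) = χ (-1) * χ' (-1) := by simp [f]
        rw [this, hneg, ← sq, hm1]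
      · have : f 4 = χ 4 * χ' 4 := by simp [f]
        rw [this, hfour, ← sq, h4sq]
    have hf' : χ D * χ' D = 1 := hf
    have heq : χ D = star (χ' D) := by
      linear_combination star (χ' D) * hf' - χ D * mul_star_of_pow_four_eq_one hv4'
    rw [t1, t2, t1', t2', heq, hneg]
    have hs : ∀ z : GaussianInt, star (χ' D) = z ↔ χ' D = star z := fun z =>
      ⟨fun e => by rw [← e, star_star], fun e => by rw [e, star_star]⟩
    rw [hs, hs, star_mul', star_mul', star_neg, hm1', star_I]
    simp

/-- The trace at `p = x² + y²` is `± 2 y` exactly when `D` is a non-residue, which by quadratic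
reciprocity is a condition on the Legendre symbols of `x² + y²` at the odd prime factors of `D`. -/
theorem frobTrace_eq_or_eq_iff {p : ℕ} (hp : p.Prime) {x y D : ℤ}
    (h : x ^ 2 + y ^ 2 = p) (hy : Even y) (hy0 : y ≠ 0)
    (hD : Odd D ∨ ((4 : ℤ) ∣ D ∧ ¬ (8 : ℤ) ∣ D)) (hpD : ¬ (p : ℤ) ∣ D) :
    (frobTrace D p = 2 * y ∨ frobTrace D p = 2 * -y) ↔
      ∏ l ∈ oddPrimes D, jacobiSym (x ^ 2 + y ^ 2) l ^ D.natAbs.factorization l = -1 := by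
  have hx := odd_of_prime_sq_add_sq hp h hy
  wlog hn : x ≡ y - 1 [ZMOD 4] generalizing x
  · have key := this (x := -x) (by rw [neg_sq, h]) hx.neg (by
      unfold Int.ModEq at hn ⊢
      rw [Int.odd_iff] at hx
      obtain ⟨k, rfl⟩ := hy
      omega)
    rwa [neg_sq] at key
  have := Fact.mk hp
  obtain ⟨χ, hχ, hJ⟩ := exists_quartic_jacobiSum_eq h hy hn
  have h0 := ne_zero_of_odd_or_four_dvd hD
  have hDp : (D : ZMod p) ≠ 0 := by rwa [Ne, ZMod.intCast_zmod_eq_zero_iff_dvd]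
  obtain ⟨t1, t2⟩ := frobTrace_eq_iff hχ hJ hx hy hy0 hpD
  rw [t1, t2, ← quadraticChar_eq_neg_one_iff hχ hDp, h]
  have hp4 : p % 4 = 1 := by
    have := four_dvd_of_orderOf hχ
    have := hp.one_lt
    omega
  have hpodd : Odd p := Nat.odd_iff.mpr (by omega)
  have hchar : ringChar (ZMod p) ≠ 2 := by
    rw [ZMod.ringChar_zmod_n]; exact ne_two_of_orderOf hχ
  let f : ℤ →* ℤ :=
    { toFun := fun n => quadraticChar (ZMod p) n
      map_one' := by simp
      map_mul' := fun a b => by push_cast; rw [map_mul] }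
  have hf : f D = ∏ l ∈ oddPrimes D, f l ^ D.natAbs.factorization l := by
    refine map_eq_prod_oddPrimes f hD ?_ ?_
    · have : f (-1) = quadraticChar (ZMod p) (-1) := by simp [f]
      rw [this, quadraticChar_neg_one hchar, ZMod.card]
      exact ZMod.χ₄_nat_one_mod_four hp4
    · have : f 4 = quadraticChar (ZMod p) (2 ^ 2) := by
        simp only [f, MonoidHom.coe_mk, OneHom.coe_mk]
        norm_num
      rw [this, quadraticChar_sq_one' (Ring.two_ne_zero hchar)]
  have hf' : quadraticChar (ZMod p) D = ∏ l ∈ oddPrimes D, f l ^ D.natAbs.factorization l := hf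
  rw [hf', Finset.prod_congr rfl]
  intro l hl
  obtain ⟨hl1, hl2, -⟩ := (mem_oddPrimes h0).mp hl
  have : f l = legendreSym p l := rfl
  rw [this, jacobiSym.legendreSym.to_jacobiSym,
    jacobiSym.quadratic_reciprocity_one_mod_four' (hl1.odd_of_ne_two hl2) hp4]

/-! ### Convergence of the Hardy–Littlewood product -/

/-- The nontrivial character modulo `4` as a real-valued function. -/
noncomputable def chiFour (n : ℕ) : ℝ :=
  (ZMod.χ₄ n : ℝ)

theorem abs_chiFour_le_one (n : ℕ) : |chiFour n| ≤ 1 := by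
  unfold chiFour
  rw [ZMod.χ₄_nat_eq_if_mod_four]
  split_ifs <;> simp

theorem chiFour_mul (m n : ℕ) : chiFour (m * n) = chiFour m * chiFour n := by
  unfold chiFour
  rw [Nat.cast_mul, map_mul, Int.cast_mul]

theorem sum_range_chiFour (n : ℕ) :
    ∑ i ∈ Finset.range n, chiFour i = if n % 4 = 2 ∨ n % 4 = 3 then 1 else 0 := by
  induction n with
  | zero => simp
  | succ n ih =>
    rw [Finset.sum_range_succ, ih, chiFour, ZMod.χ₄_nat_eq_if_mod_four]
    have : n % 4 < 4 := Nat.mod_lt _ (by norm_num)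
    split_ifs <;> first | omega | norm_num

/-- Summation by parts against an antitone weight. -/
theorem abs_sum_Ico_mul_chiFour_le {f : ℕ → ℝ} {m n : ℕ} (hmn : m ≤ n)
    (hf : AntitoneOn f (Set.Ici m)) (hf0 : ∀ k, m ≤ k → 0 ≤ f k) :
    |∑ k ∈ Finset.Ico m n, f k * chiFour k| ≤ f m := by
  set A : ℕ → ℝ := fun k => ∑ i ∈ Finset.range k, chiFour i with hA
  have hA01 : ∀ k, 0 ≤ A k ∧ A k ≤ 1 := fun k => by
    simp only [hA, sum_range_chiFour]
    split_ifs <;> norm_num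
  have key : 0 ≤ ∑ k ∈ Finset.Ico m n, f k * chiFour k - f n * A n + f m * A m ∧
      ∑ k ∈ Finset.Ico m n, f k * chiFour k - f n * A n + f m * A m ≤ f m - f n := by
    induction n, hmn using Nat.le_induction with
    | base => simp
    | succ n hmn ih =>
      have hc : chiFour n = A (n + 1) - A n := by simp [hA, Finset.sum_range_succ]
      have hle : f (n + 1) ≤ f n := hf hmn (Set.mem_Ici.mpr (by omega)) (Nat.le_succ n)
      rw [Finset.sum_Ico_succ_top hmn, hc]
      have := hA01 (n + 1)
      constructor <;> nlinarith
  have h1 := hA01 n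
  have h2 := hA01 m
  have h3 := hf0 n hmn
  have h4 := hf0 m le_rfl
  rw [abs_le]
  constructor <;> nlinarith

/-- The partial sums of `L(1, χ₄)` converge to a positive limit, with the error term of an alternating
series. -/
theorem exists_tendsto_sum_chiFour_div :
    ∃ L : ℝ, 0 < L ∧ ∀ M : ℕ, |∑ k ∈ Finset.Ioc 0 M, chiFour k / k - L| ≤ 1 / ((M : ℝ) + 1) := by
  have hanti : ∀ m : ℕ, 0 < m → AntitoneOn (fun k : ℕ => 1 / (k : ℝ)) (Set.Ici m) := by
    intro m hm a ha b _ hab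
    have : 0 < a := lt_of_lt_of_le hm ha
    exact one_div_le_one_div_of_le (by exact_mod_cast this) (by exact_mod_cast hab)
  set g : ℕ → ℝ := fun M => ∑ k ∈ Finset.Ioc 0 M, chiFour k / k with hg
  have hdiff : ∀ M N : ℕ, M ≤ N → |g N - g M| ≤ 1 / ((M : ℝ) + 1) := by
    intro M N hMN
    have h := abs_sum_Ico_mul_chiFour_le (f := fun k : ℕ => 1 / (k : ℝ)) (m := M + 1) (n := N + 1)
      (by omega) (hanti _ (by omega)) (fun k _ => by positivity)
    have e : g N - g M = ∑ k ∈ Finset.Ico (M + 1) (N + 1), 1 / (k : ℝ) * chiFour k := by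
      have : Finset.Ico (M + 1) (N + 1) = Finset.Ioc M N := by
        ext k; simp only [Finset.mem_Ico, Finset.mem_Ioc]; omega
      rw [this, hg]
      simp only
      rw [← Finset.sum_Ioc_consecutive _ (Nat.zero_le M) hMN, add_sub_cancel_left]
      exact Finset.sum_congr rfl fun k _ => by ring
    rw [e]
    simpa using h
  have hlim0 : Tendsto (fun M : ℕ => 1 / ((M : ℝ) + 1)) atTop (𝓝 0) :=
    tendsto_one_div_add_atTop_nhds_zero_nat
  have hcau : CauchySeq g :=
    cauchySeq_of_le_tendsto_0' _ (fun n m hnm => by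
      rw [Real.dist_eq, abs_sub_comm]; exact hdiff n m hnm) hlim0
  obtain ⟨L, hL⟩ := cauchySeq_tendsto_of_complete hcau
  have hbound : ∀ M : ℕ, |g M - L| ≤ 1 / ((M : ℝ) + 1) := by
    intro M
    rw [abs_sub_comm]
    have h1 : Tendsto (fun N => |g N - g M|) atTop (𝓝 |L - g M|) := (hL.sub_const _).abs
    exact le_of_tendsto h1 (eventually_atTop.mpr ⟨M, fun N hN => hdiff M N hN⟩)
  refine ⟨L, ?_, hbound⟩
  have h2 := hbound 1
  have e1 : g 1 = 1 := by
    simp only [hg]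
    rw [show Finset.Ioc 0 1 = {1} from rfl, Finset.sum_singleton, chiFour]
    simp
  rw [e1] at h2
  have h3 := hbound 2
  have e2 : g 2 = 1 := by
    simp only [hg]
    rw [show Finset.Ioc 0 2 = {1, 2} from rfl, Finset.sum_pair (by norm_num), chiFour, chiFour,
      show ZMod.χ₄ ((2 : ℕ) : ZMod 4) = 0 from rfl]
    simp
  rw [e2, abs_le] at h3
  norm_num at h3
  linarith

theorem exists_bound_sum_chiFour_log_div :
    ∃ C : ℝ, ∀ N : ℕ, |∑ n ∈ Finset.Ioc 0 N, chiFour n * Real.log n / n| ≤ C := by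
  have hanti : AntitoneOn (fun k : ℕ => Real.log k / (k : ℝ)) (Set.Ici 3) := by
    intro a ha b hb hab
    have h3 : ∀ c : ℕ, c ∈ Set.Ici 3 → (c : ℝ) ∈ Set.Ici (Real.exp 1) := fun c hc => by
      have : (3 : ℝ) ≤ c := by exact_mod_cast hc
      exact Set.mem_Ici.mpr (by have := Real.exp_one_lt_d9; linarith)
    exact Real.log_div_self_antitoneOn (h3 a ha) (h3 b hb) (by exact_mod_cast hab)
  refine ⟨1 + Real.log 3 / 3, fun N => ?_⟩
  have hnn : ∀ k : ℕ, 0 ≤ Real.log k / (k : ℝ) := fun k =>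
    div_nonneg (Real.log_natCast_nonneg k) (Nat.cast_nonneg k)
  have h3 : 0 ≤ Real.log 3 / 3 := hnn 3
  rcases Nat.lt_or_ge N 2 with hN | hN
  · have : ∑ n ∈ Finset.Ioc 0 N, chiFour n * Real.log n / n = 0 := by
      refine Finset.sum_eq_zero fun n hn => ?_
      rw [Finset.mem_Ioc] at hn
      have : n = 1 := by omega
      subst this; simp
    rw [this, abs_zero]
    linarith
  · have h := abs_sum_Ico_mul_chiFour_le (m := 3) (n := N + 1) (by omega) hanti (fun k _ => hnn k)
    have e : ∑ n ∈ Finset.Ioc 0 N, chiFour n * Real.log n / n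
        = ∑ k ∈ Finset.Ico 3 (N + 1), Real.log k / (k : ℝ) * chiFour k := by
      have : Finset.Ico 3 (N + 1) = Finset.Ioc 2 N := by
        ext k; simp only [Finset.mem_Ico, Finset.mem_Ioc]; omega
      rw [this, ← Finset.sum_Ioc_consecutive _ (Nat.zero_le 2) hN,
        show Finset.Ioc 0 2 = {1, 2} from rfl, Finset.sum_pair (by norm_num), chiFour, chiFour,
        show ZMod.χ₄ ((2 : ℕ) : ZMod 4) = 0 from rfl]
      simp only [Nat.cast_one, Real.log_one, mul_zero, zero_div, Int.cast_zero, zero_mul, add_zero,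
        zero_add]
      exact Finset.sum_congr rfl fun k _ => by ring
    rw [e]
    have h' : |∑ k ∈ Finset.Ico 3 (N + 1), Real.log k / (k : ℝ) * chiFour k| ≤ Real.log 3 / 3 := by
      exact_mod_cast h
    linarith

/-- Mertens' argument: as `∑ χ(n) log n / n` is the convolution of `χ Λ / n` with `χ / n`, whose
partial sums tend to `L(1, χ) ≠ 0` at rate `O(1/n)`, Chebyshev's bound makes `∑ χ(n) Λ(n) / n`
bounded. -/
theorem exists_bound_sum_chiFour_vonMangoldt :
    ∃ C : ℝ, ∀ N : ℕ,
      |∑ n ∈ Finset.Ioc 0 N, chiFour n * ArithmeticFunction.vonMangoldt n / n| ≤ C := by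
  obtain ⟨L, hL0, hL⟩ := exists_tendsto_sum_chiFour_div
  obtain ⟨C, hC⟩ := exists_bound_sum_chiFour_log_div
  let f : ArithmeticFunction ℝ :=
    ⟨fun n => chiFour n * ArithmeticFunction.vonMangoldt n / n, by simp⟩
  let g : ArithmeticFunction ℝ := ⟨fun n => chiFour n / n, by simp⟩
  have hfg : ∀ n, (f * g) n = chiFour n * Real.log n / n := by
    intro n
    rw [ArithmeticFunction.mul_apply, ← ArithmeticFunction.vonMangoldt_sum, Finset.mul_sum,
      Finset.sum_div, Nat.sum_divisorsAntidiagonal fun d e => f d * g e]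
    refine Finset.sum_congr rfl fun d hd => ?_
    obtain ⟨e, rfl⟩ := Nat.dvd_of_mem_divisors hd
    have hd0 : 0 < d := Nat.pos_of_mem_divisors hd
    rw [Nat.mul_div_cancel_left _ hd0]
    simp only [f, g, ArithmeticFunction.coe_mk, chiFour_mul]
    push_cast
    rw [div_mul_div_comm]
    ring
  refine ⟨(C + (Real.log 4 + 4)) / L, fun N => ?_⟩
  have hconv := ArithmeticFunction.sum_Ioc_mul_eq_sum_sum f g N
  simp_rw [hfg] at hconv
  have hsplit : ∑ n ∈ Finset.Ioc 0 N, f n * ∑ m ∈ Finset.Ioc 0 (N / n), g m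
      = L * ∑ n ∈ Finset.Ioc 0 N, f n
        + ∑ n ∈ Finset.Ioc 0 N, f n * (∑ m ∈ Finset.Ioc 0 (N / n), g m - L) := by
    rw [Finset.mul_sum, ← Finset.sum_add_distrib]
    exact Finset.sum_congr rfl fun n _ => by ring
  have herr : |∑ n ∈ Finset.Ioc 0 N, f n * (∑ m ∈ Finset.Ioc 0 (N / n), g m - L)|
      ≤ Real.log 4 + 4 := by
    rcases Nat.eq_zero_or_pos N with rfl | hN
    · simp only [Finset.Ioc_self, Finset.sum_empty, abs_zero]
      have := Real.log_nonneg (show (1 : ℝ) ≤ 4 by norm_num)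
      linarith
    have hNr : (0 : ℝ) < N := by exact_mod_cast hN
    have hterm : ∀ n ∈ Finset.Ioc 0 N, |f n * (∑ m ∈ Finset.Ioc 0 (N / n), g m - L)|
        ≤ ArithmeticFunction.vonMangoldt n / N := by
      intro n hn
      have hn0 : 0 < n := (Finset.mem_Ioc.mp hn).1
      have hnr : (0 : ℝ) < n := by exact_mod_cast hn0
      have h1 : |∑ m ∈ Finset.Ioc 0 (N / n), g m - L| ≤ n / N := by
        refine (hL (N / n)).trans ?_
        rw [div_le_div_iff₀ (by positivity) hNr, one_mul]
        have : N < n * (N / n + 1) := Nat.lt_mul_div_succ N hn0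
        exact_mod_cast this.le
      have h2 : |f n| ≤ ArithmeticFunction.vonMangoldt n / n := by
        simp only [f, ArithmeticFunction.coe_mk]
        rw [abs_div, abs_mul, Nat.abs_cast, abs_of_nonneg ArithmeticFunction.vonMangoldt_nonneg]
        gcongr
        exact mul_le_of_le_one_left ArithmeticFunction.vonMangoldt_nonneg (abs_chiFour_le_one n)
      rw [abs_mul]
      calc _ ≤ ArithmeticFunction.vonMangoldt n / n * (n / N) :=
            mul_le_mul h2 h1 (abs_nonneg _) (div_nonneg ArithmeticFunction.vonMangoldt_nonneg hnr.le)
        _ = _ := by field_simp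
    refine (Finset.abs_sum_le_sum_abs _ _).trans ((Finset.sum_le_sum hterm).trans ?_)
    rw [← Finset.sum_div, div_le_iff₀ hNr]
    have := Chebyshev.psi_le_const_mul_self hNr.le
    rwa [Chebyshev.psi, Nat.floor_natCast] at this
  have h := hC N
  rw [hconv, hsplit] at h
  rw [le_div_iff₀ hL0, ← abs_of_pos hL0, ← abs_mul, mul_comm]
  have e : L * ∑ n ∈ Finset.Ioc 0 N, f n
      = (L * ∑ n ∈ Finset.Ioc 0 N, f n
        + ∑ n ∈ Finset.Ioc 0 N, f n * (∑ m ∈ Finset.Ioc 0 (N / n), g m - L))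
        - ∑ n ∈ Finset.Ioc 0 N, f n * (∑ m ∈ Finset.Ioc 0 (N / n), g m - L) := by ring
  change |L * ∑ n ∈ Finset.Ioc 0 N, f n| ≤ _
  rw [e]
  exact (abs_sub _ _).trans (add_le_add h herr)

/-- Convergence of `∑ χ₄(p) / p`, by Dirichlet's test with the weight `1 / log p` from the boundedness
of `∑ χ₄(p) log p / p`. -/
theorem exists_tendsto_sum_chiFour_div_prime :
    ∃ l : ℝ, Tendsto (fun N : ℕ => ∑ n ∈ Finset.range N, if n.Prime then chiFour n / n else 0)
      atTop (𝓝 l) := by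
  obtain ⟨C, hC⟩ := exists_bound_sum_chiFour_vonMangoldt
  have hsum : Summable fun n : ℕ =>
      (if n.Prime then 0 else ArithmeticFunction.vonMangoldt n) / n := by
    have := ArithmeticFunction.vonMangoldt.summable_residueClass_non_primes_div (0 : ZMod 1)
    refine this.congr fun n => ?_
    have : ({n : ℕ | (n : ZMod 1) = 0} : Set ℕ) = Set.univ :=
      Set.eq_univ_of_forall fun n => Subsingleton.elim _ _
    rw [ArithmeticFunction.vonMangoldt.residueClass, this, Set.indicator_univ]
  set T := ∑' n : ℕ, (if n.Prime then 0 else ArithmeticFunction.vonMangoldt n) / (n : ℝ)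
  have hnn : ∀ n : ℕ, 0 ≤ (if n.Prime then 0 else ArithmeticFunction.vonMangoldt n) / (n : ℝ) := by
    intro n
    have := ArithmeticFunction.vonMangoldt_nonneg (n := n)
    split_ifs <;> positivity
  let z : ℕ → ℝ := fun n => if n.Prime then chiFour n * Real.log n / n else 0
  let w : ℕ → ℝ := fun n => 1 / Real.log (max n 2 : ℕ)
  have hz : ∀ n, ‖∑ i ∈ Finset.range n, z i‖ ≤ C + T := by
    intro n
    have hpt : ∀ i : ℕ, z i = chiFour i * ArithmeticFunction.vonMangoldt i / i
        - chiFour i * ((if i.Prime then 0 else ArithmeticFunction.vonMangoldt i) / (i : ℝ)) := by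
      intro i
      by_cases hi : i.Prime
      · simp [z, hi, ArithmeticFunction.vonMangoldt_apply_prime hi]
      · simp [z, hi]; ring
    have h1 : |∑ i ∈ Finset.range n, chiFour i * ArithmeticFunction.vonMangoldt i / i| ≤ C := by
      rcases n with _ | n
      · simpa using hC 0
      · have := hC n
        rwa [Finset.range_eq_Ico, ← Finset.sum_Ioo_add_eq_sum_Ico (Nat.succ_pos n),
          show Finset.Ioo 0 (n + 1) = Finset.Ioc 0 n by
            ext k; simp only [Finset.mem_Ioo, Finset.mem_Ioc]; omega,
          show chiFour (0 : ℕ) * ArithmeticFunction.vonMangoldt 0 / ((0 : ℕ) : ℝ) = 0 by simp,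
          add_zero]
    have h2 : |∑ i ∈ Finset.range n,
        chiFour i * ((if i.Prime then 0 else ArithmeticFunction.vonMangoldt i) / (i : ℝ))| ≤ T := by
      refine (Finset.abs_sum_le_sum_abs _ _).trans
        ((Finset.sum_le_sum fun i _ => ?_).trans (hsum.sum_le_tsum _ fun i _ => hnn i))
      rw [abs_mul, abs_of_nonneg (hnn i)]
      exact mul_le_of_le_one_left (hnn i) (abs_chiFour_le_one i)
    simp_rw [hpt]
    rw [Finset.sum_sub_distrib, Real.norm_eq_abs]
    exact (abs_sub _ _).trans (add_le_add h1 h2)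
  have hlog : ∀ n : ℕ, 0 < Real.log (max n 2 : ℕ) := fun n =>
    Real.log_pos (by exact_mod_cast lt_of_lt_of_le one_lt_two (le_max_right n 2))
  have hw : Antitone w := fun a b hab => by
    refine one_div_le_one_div_of_le (hlog a) (Real.log_le_log ?_ ?_)
    · exact_mod_cast lt_of_lt_of_le zero_lt_two (le_max_right a 2)
    · exact_mod_cast max_le_max_right 2 hab
  have hw0 : Tendsto w atTop (𝓝 0) := by
    simp only [w, one_div]
    refine tendsto_inv_atTop_zero.comp (Real.tendsto_log_atTop.comp ?_)
    refine tendsto_natCast_atTop_atTop.comp ?_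
    exact tendsto_atTop_mono (fun n => le_max_left n 2) tendsto_id
  have hcau := hw.cauchySeq_series_mul_of_tendsto_zero_of_bounded hw0 hz
  obtain ⟨l, hl⟩ := cauchySeq_tendsto_of_complete hcau
  refine ⟨l, hl.congr fun N => Finset.sum_congr rfl fun n _ => ?_⟩
  by_cases hn : n.Prime
  · have h2 : max n 2 = n := max_eq_left hn.two_le
    have h3 := hlog n
    rw [h2] at h3
    simp only [z, w, hn, if_true, h2, smul_eq_mul]
    field_simp
  · simp [z, hn]

/-- For `Δ = -k²` the partial products in the Hardy–Littlewood constant converge, and not to `0`: up to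
an absolutely convergent series, their logarithms are `-∑ χ₄(p) / p`. -/
theorem hlProduct_ne_zero {a b c k : ℤ} (ha : a ≠ 0) (hk : k ≠ 0)
    (hΔ : b ^ 2 - 4 * a * c = -k ^ 2) : hlProduct a b c ≠ 0 := by
  classical
  set j : ℕ → ℝ := fun p => (jacobiSym (b ^ 2 - 4 * a * c) p : ℝ) with hj
  set F : ℕ → ℝ := fun n =>
    if n.Prime ∧ 2 < n ∧ ¬ (n : ℤ) ∣ a then 1 - j n / ((n : ℝ) - 1) else 1 with hF
  have hjle : ∀ n, |j n| ≤ 1 := by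
    intro n
    rcases jacobiSym.trichotomy (b ^ 2 - 4 * a * c) n with h | h | h <;> simp [hj, h]
  have hx : ∀ n : ℕ, 2 < n → |j n / ((n : ℝ) - 1)| ≤ 1 / ((n : ℝ) - 1) ∧
      1 / ((n : ℝ) - 1) ≤ 1 / 2 ∧ 0 < (n : ℝ) - 1 := by
    intro n hn
    have hn' : (3 : ℝ) ≤ n := by exact_mod_cast hn
    have hpos : 0 < (n : ℝ) - 1 := by linarith
    refine ⟨?_, one_div_le_one_div_of_le two_pos (by linarith), hpos⟩
    rw [abs_div, abs_of_pos hpos]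
    gcongr
    exact hjle n
  have hFpos : ∀ n, 0 < F n := by
    intro n
    simp only [hF]
    split_ifs with h
    · obtain ⟨h1, h2, -⟩ := hx n h.2.1
      have := (abs_le.mp (h1.trans h2)).2
      linarith
    · exact one_pos
  set r : ℕ → ℝ := fun n => Real.log (F n) + if n.Prime then chiFour n / n else 0 with hr
  have hjchi : ∀ n : ℕ, n.Prime → a.natAbs * k.natAbs + 2 < n → j n = chiFour n ∧ ¬ (n : ℤ) ∣ a := by
    intro n hn hlt
    have ha' : 0 < a.natAbs := Int.natAbs_pos.mpr ha
    have hk' : 0 < k.natAbs := Int.natAbs_pos.mpr hk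
    have hna : ¬ (n : ℤ) ∣ a := fun h => by
      have := Nat.le_of_dvd ha' (Int.natCast_dvd.mp h)
      nlinarith
    have hnk : ¬ (n : ℤ) ∣ k := fun h => by
      have := Nat.le_of_dvd hk' (Int.natCast_dvd.mp h)
      nlinarith
    refine ⟨?_, hna⟩
    have hodd : Odd n := hn.odd_of_ne_two (by omega)
    have hcop : k.gcd n = 1 := by
      rw [Int.gcd_comm]
      exact Int.isCoprime_iff_gcd_eq_one.mp
        ((Nat.prime_iff_prime_int.mp hn).coprime_iff_not_dvd.mpr hnk)
    simp only [hj, chiFour, hΔ]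
    rw [jacobiSym.neg _ hodd, jacobiSym.sq_one' hcop, mul_one]
  have hrbound : ∀ n : ℕ, a.natAbs * k.natAbs + 2 < n → |r n| ≤ 12 * (1 / (n : ℝ) ^ 2) := by
    intro n hlt
    have hn2 : 2 < n := by omega
    by_cases hn : n.Prime
    · obtain ⟨hjn, hna⟩ := hjchi n hn hlt
      obtain ⟨h1, h2, h3⟩ := hx n hn2
      have hFn : F n = 1 - j n / ((n : ℝ) - 1) := by
        simp only [hF]; rw [if_pos ⟨hn, hn2, hna⟩]
      set x := j n / ((n : ℝ) - 1) with hxdef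
      have hn' : (3 : ℝ) ≤ n := by exact_mod_cast hn2
      have hlog := Real.abs_log_sub_add_sum_range_le (x := x) (by linarith) 1
      simp only [Finset.sum_range_one, zero_add, pow_one, Nat.cast_zero, div_one] at hlog
      have hlog' : |x + Real.log (1 - x)| ≤ 2 * (1 / ((n : ℝ) - 1)) ^ 2 := by
        refine hlog.trans ?_
        rw [div_le_iff₀ (by linarith)]
        have h5 : |x| ^ 2 ≤ (1 / ((n : ℝ) - 1)) ^ 2 := pow_le_pow_left₀ (abs_nonneg _) h1 2
        have h6 : 0 ≤ (1 / ((n : ℝ) - 1)) ^ 2 := sq_nonneg _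
        norm_num
        norm_num at h5 h6
        nlinarith
      have e : r n = (x + Real.log (1 - x)) - chiFour n * (1 / ((n : ℝ) - 1) - 1 / n) := by
        simp only [hr, hFn, if_pos hn]
        rw [hxdef, hjn]
        ring
      have h7 : 1 / ((n : ℝ) - 1) ≤ 2 / n := by
        rw [div_le_div_iff₀ h3 (by linarith)]; linarith
      have h8 : 0 ≤ 1 / ((n : ℝ) - 1) - 1 / n ∧ 1 / ((n : ℝ) - 1) - 1 / n ≤ 2 / (n : ℝ) ^ 2 := by
        have : 1 / ((n : ℝ) - 1) - 1 / n = 1 / ((n : ℝ) - 1) * (1 / n) := by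
          field_simp; ring
        rw [this]
        refine ⟨by positivity, ?_⟩
        calc 1 / ((n : ℝ) - 1) * (1 / n) ≤ 2 / n * (1 / n) := by gcongr
          _ = 2 / (n : ℝ) ^ 2 := by rw [div_mul_div_comm, mul_one, sq]
      have h9 : |chiFour n * (1 / ((n : ℝ) - 1) - 1 / n)| ≤ 2 / (n : ℝ) ^ 2 := by
        rw [abs_mul, abs_of_nonneg h8.1]
        exact (mul_le_of_le_one_left h8.1 (abs_chiFour_le_one n)).trans h8.2
      have h10 : (1 / ((n : ℝ) - 1)) ^ 2 ≤ (2 / n) ^ 2 := by gcongr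
      rw [e]
      refine (abs_sub _ _).trans ((add_le_add hlog' h9).trans ?_)
      rw [div_pow (2 : ℝ)] at h10
      have : (0 : ℝ) ≤ 1 / (n : ℝ) ^ 2 := by positivity
      have e2 : (2 : ℝ) ^ 2 / (n : ℝ) ^ 2 = 4 * (1 / (n : ℝ) ^ 2) := by ring
      have e3 : (2 : ℝ) / (n : ℝ) ^ 2 = 2 * (1 / (n : ℝ) ^ 2) := by ring
      rw [e2] at h10
      rw [e3]
      linarith
    · have : r n = 0 := by
        simp [hr, hF, hn]
      rw [this, abs_zero]
      positivity
  have hrsum : Summable r := by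
    have hs : Summable fun n : ℕ => 12 * (1 / (n : ℝ) ^ 2) :=
      (Real.summable_one_div_nat_pow.mpr one_lt_two).mul_left 12
    refine Summable.of_norm_bounded_eventually_nat hs ?_
    exact eventually_atTop.mpr ⟨a.natAbs * k.natAbs + 3, fun n hn => hrbound n (by omega)⟩
  obtain ⟨l, hl⟩ := exists_tendsto_sum_chiFour_div_prime
  have hlogsum : Tendsto (fun N : ℕ => ∑ n ∈ Finset.range N, Real.log (F n)) atTop
      (𝓝 (∑' n, r n - l)) := by
    refine (hrsum.hasSum.tendsto_sum_nat.sub hl).congr fun N => ?_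
    rw [← Finset.sum_sub_distrib]
    exact Finset.sum_congr rfl fun n _ => by simp [hr]
  have hprod : Tendsto (fun N : ℕ => ∏ n ∈ Finset.range (N + 1), F n) atTop
      (𝓝 (Real.exp (∑' n, r n - l))) := by
    refine ((Real.continuous_exp.tendsto _).comp
      (hlogsum.comp (tendsto_add_atTop_nat 1))).congr fun N => ?_
    simp only [Function.comp]
    rw [Real.exp_sum]
    exact Finset.prod_congr rfl fun n _ => Real.exp_log (hFpos n)
  have hval : hlProduct a b c = Real.exp (∑' n, r n - l) := by
    unfold hlProduct
    refine Tendsto.limUnder_eq (hprod.congr fun N => ?_)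
    rw [Finset.prod_filter]
  rw [hval]
  exact Real.exp_ne_zero _

/-! ### Primes `x² + b²` in residue classes of `x` -/

/-- For the polynomial `(M y + r)² + β²` the Hardy–Littlewood constant does not depend on `r`. -/
theorem hlConst_shift {M r β : ℤ} (hM : Even M) :
    hlConst (M ^ 2) (2 * M * r) (r ^ 2 + β ^ 2) = hlConst (M ^ 2) 0 (β ^ 2) := by
  have h1 : Int.gcd 2 (M ^ 2 + 2 * M * r) = Int.gcd 2 (M ^ 2 + 0) := by
    have e1 : (2 : ℤ) ∣ M ^ 2 := (hM.two_dvd).pow two_ne_zero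
    have e2 : (2 : ℤ) ∣ M ^ 2 + 2 * M * r := e1.add ⟨M * r, by ring⟩
    rw [add_zero, Int.gcd_eq_natAbs_left_iff_dvd.mpr e1, Int.gcd_eq_natAbs_left_iff_dvd.mpr e2]
  have h2 : (M ^ 2).natAbs.primeFactors.filter (fun p : ℕ => 2 < p ∧ (p : ℤ) ∣ 2 * M * r)
      = (M ^ 2).natAbs.primeFactors.filter (fun p : ℕ => 2 < p ∧ (p : ℤ) ∣ 0) := by
    refine Finset.filter_congr fun p hp => ?_
    have hpp := Nat.prime_of_mem_primeFactors hp
    have h3 : (p : ℤ) ∣ M ^ 2 := Int.natCast_dvd.mpr (Nat.dvd_of_mem_primeFactors hp)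
    have h4 : (p : ℤ) ∣ M := (Nat.prime_iff_prime_int.mp hpp).dvd_of_dvd_pow h3
    simp [(h4.mul_left 2).mul_right r]
  have h3 : (2 * M * r) ^ 2 - 4 * M ^ 2 * (r ^ 2 + β ^ 2) = 0 ^ 2 - 4 * M ^ 2 * β ^ 2 := by ring
  unfold hlConst hlProduct
  rw [h1, h2, h3]

theorem hlConst_shift_ne_zero {M β : ℤ} (hM : Even M) (hM0 : M ≠ 0) (hβ : β ≠ 0) :
    hlConst (M ^ 2) 0 (β ^ 2) ≠ 0 := by
  have hM2 : (0 : ℝ) < ((M ^ 2 : ℤ) : ℝ) := by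
    have : 0 < M ^ 2 := by positivity
    exact_mod_cast this
  unfold hlConst
  refine mul_ne_zero (mul_ne_zero (div_ne_zero ?_ (Real.sqrt_pos.mpr hM2).ne') ?_) ?_
  · have e1 : (2 : ℤ) ∣ M ^ 2 + 0 := by
      rw [add_zero]; exact (hM.two_dvd).pow two_ne_zero
    rw [Int.gcd_eq_natAbs_left_iff_dvd.mpr e1]
    norm_num
  · refine Finset.prod_ne_zero_iff.mpr fun p hp => ?_
    have hp2 : (2 : ℝ) < p := by exact_mod_cast (Finset.mem_filter.mp hp).2.1
    exact div_ne_zero (by linarith) (by linarith)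
  · exact hlProduct_ne_zero (k := 2 * M * β) (pow_ne_zero _ hM0)
      (mul_ne_zero (mul_ne_zero two_ne_zero hM0) hβ) (by ring)

/-- The growth function `√n / log n` of the Hardy–Littlewood conjecture. -/
noncomputable def hlGrowth (n : ℕ) : ℝ :=
  Real.sqrt n / Real.log n

theorem eventually_hlGrowth_ne_zero : ∀ᶠ n in atTop, hlGrowth n ≠ 0 := by
  refine eventually_atTop.mpr ⟨2, fun n hn => ?_⟩
  have h1 : (1 : ℝ) < n := by exact_mod_cast hn
  exact div_ne_zero (Real.sqrt_pos.mpr (by linarith)).ne' (Real.log_pos h1).ne'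

theorem tendsto_const_div_hlGrowth (C : ℝ) :
    Tendsto (fun n : ℕ => C / hlGrowth n) atTop (𝓝 0) := by
  have h := (isLittleO_log_rpow_atTop (show (0 : ℝ) < 1 / 2 by norm_num)).tendsto_div_nhds_zero
  have h2 := (h.comp tendsto_natCast_atTop_atTop).const_mul C
  rw [mul_zero] at h2
  refine h2.congr fun n => ?_
  simp only [Function.comp, hlGrowth, Real.sqrt_eq_rpow]
  rw [div_div_eq_mul_div, mul_div_assoc]

open Classical in
/-- The primes `p ≤ N` of the form `x² + b²`. -/
noncomputable def sqAddPrimes (b N : ℕ) : Finset ℕ :=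
  (Finset.range (N + 1)).filter fun p => p.Prime ∧ ∃ x : ℕ, p = x ^ 2 + b ^ 2

theorem mem_sqAddPrimes {b N p : ℕ} :
    p ∈ sqAddPrimes b N ↔ p ≤ N ∧ p.Prime ∧ ∃ x : ℕ, p = x ^ 2 + b ^ 2 := by
  simp [sqAddPrimes]

theorem coe_sqAddPrimes (β : ℤ) (N : ℕ) :
    (sqAddPrimes β.natAbs N : Set ℕ) = quadPrimes β N := by
  ext p
  simp only [Finset.mem_coe, mem_sqAddPrimes, quadPrimes, Set.mem_ofPred_eq]
  constructor
  · rintro ⟨h1, h2, x, h3⟩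
    refine ⟨h2, h1, x, ?_⟩
    rw [h3]; push_cast; rw [sq_abs]; ring
  · rintro ⟨h2, h1, x, h3⟩
    refine ⟨h1, h2, x.natAbs, ?_⟩
    zify
    rw [h3, sq_abs, sq_abs]; ring

/-- The residue class modulo `M` of the nonnegative `x` with `p = x² + b²`. -/
def sqAddClass (M b p : ℕ) : ZMod M :=
  (Nat.sqrt (p - b ^ 2) : ℕ)

theorem sqAddClass_eq (M b x : ℕ) : sqAddClass M b (x ^ 2 + b ^ 2) = x := by
  rw [sqAddClass, Nat.add_sub_cancel, sq, Nat.sqrt_eq]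

theorem card_filter_sqAddClass {M : ℕ} [NeZero M] (b N : ℕ) (c : ZMod M) :
    ((sqAddPrimes b N).filter fun p => sqAddClass M b p = c).card
      = quadPrimeCount ((M : ℤ) ^ 2) (2 * M * c.val) ((c.val : ℤ) ^ 2 + (b : ℤ) ^ 2) (N + 1) := by
  rw [quadPrimeCount, ← Set.ncard_coe_finset]
  congr 1
  ext p
  simp only [Finset.coe_filter, mem_sqAddPrimes, Set.mem_ofPred_eq]
  constructor
  · rintro ⟨⟨h1, h2, x, rfl⟩, h3⟩
    refine ⟨h2, by omega, x / M, ?_⟩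
    rw [sqAddClass_eq] at h3
    have hx : x = M * (x / M) + c.val := by
      rw [← h3, ZMod.val_natCast, Nat.div_add_mod]
    conv_lhs => rw [hx]
    push_cast; ring
  · rintro ⟨h2, h1, y, h3⟩
    have h4 : p = (M * y + c.val) ^ 2 + b ^ 2 := by
      zify; rw [h3]; ring
    refine ⟨⟨by omega, h2, _, h4⟩, ?_⟩
    rw [h4, sqAddClass_eq]
    simp

/-- Each admissible residue class of `x` contains, asymptotically, the same number of primes
`x² + b²`. -/
theorem tendsto_card_filter_sqAddClass (hHL : HardyLittlewoodConjecture) {M : ℕ} [NeZero M]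
    (hM : Even M) {b : ℕ} (hb : b ≠ 0) {c : ZMod M} (hc : IsUnit (c ^ 2 + (b : ZMod M) ^ 2)) :
    Tendsto (fun N : ℕ => (((sqAddPrimes b N).filter fun p => sqAddClass M b p = c).card : ℝ)
      / hlGrowth (N + 1)) atTop (𝓝 (hlConst ((M : ℤ) ^ 2) 0 ((b : ℤ) ^ 2))) := by
  have hM0 : (M : ℤ) ≠ 0 := by exact_mod_cast NeZero.ne M
  have hMe : Even (M : ℤ) := by exact_mod_cast hM
  have hb0 : (b : ℤ) ≠ 0 := by exact_mod_cast hb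
  set a₀ : ℤ := (M : ℤ) ^ 2 with ha₀
  set b₀ : ℤ := 2 * M * c.val with hb₀
  set c₀ : ℤ := (c.val : ℤ) ^ 2 + (b : ℤ) ^ 2 with hc₀
  have hcop : IsCoprime (M : ℤ) c₀ := by
    have h1 : (c ^ 2 + (b : ZMod M) ^ 2) = ((c.val ^ 2 + b ^ 2 : ℕ) : ZMod M) := by
      push_cast; rw [ZMod.natCast_zmod_val]
    rw [h1, ZMod.isUnit_iff_coprime] at hc
    have := Nat.isCoprime_iff_coprime.mpr hc.symm
    rw [hc₀]
    exact_mod_cast this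
  have hodd : ¬ Even c₀ := fun he => by
    have h2 := hcop.isUnit_of_dvd' hMe.two_dvd he.two_dvd
    exact absurd h2 (by decide)
  have hgcd : Int.gcd (Int.gcd a₀ b₀) c₀ = 1 := by
    apply Int.isCoprime_iff_gcd_eq_one.mp
    exact (hcop.pow_left (m := 2)).of_isCoprime_of_dvd_left (Int.gcd_dvd_left ..)
  have hΔ : b₀ ^ 2 - 4 * a₀ * c₀ = -(2 * M * b) ^ 2 := by rw [ha₀, hb₀, hc₀]; ring
  have hns : ¬ IsSquare (b₀ ^ 2 - 4 * a₀ * c₀) := by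
    rw [hΔ]
    intro h
    have h1 := h.nonneg
    have h2 : 0 < (2 * (M : ℤ) * b) ^ 2 := by positivity
    linarith
  have ha₀pos : 0 < a₀ := by positivity
  have hequiv := hHL a₀ b₀ c₀ ha₀pos hgcd (fun h => hodd h.2) hns
  rw [hlConst_shift hMe] at hequiv
  have hκ := hlConst_shift_ne_zero hMe hM0 hb0
  rw [← ha₀] at hκ
  set κ := hlConst a₀ 0 ((b : ℤ) ^ 2)
  have hne : ∀ᶠ n : ℕ in atTop, κ * (Real.sqrt n / Real.log n) ≠ 0 :=
    eventually_hlGrowth_ne_zero.mono fun n hn => mul_ne_zero hκ hn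
  have h1 := ((Asymptotics.isEquivalent_iff_tendsto_one hne).mp hequiv).const_mul κ
  rw [mul_one] at h1
  refine ((h1.comp (tendsto_add_atTop_nat 1))).congr fun N => ?_
  simp only [Function.comp, Pi.div_apply]
  rw [card_filter_sqAddClass, hlGrowth, ← mul_div_assoc, mul_div_mul_left _ _ hκ]

theorem isUnit_of_prime_eq_sq_add {M b p x : ℕ} [NeZero M] (hp : p.Prime) (hpM : M < p)
    (h : p = x ^ 2 + b ^ 2) : IsUnit ((x : ZMod M) ^ 2 + (b : ZMod M) ^ 2) := by
  have h1 : ((x : ZMod M) ^ 2 + (b : ZMod M) ^ 2) = (p : ZMod M) := by rw [h]; push_cast; rfl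
  rw [h1, ZMod.isUnit_iff_coprime, hp.coprime_iff_not_dvd]
  exact fun hd => absurd (Nat.le_of_dvd (NeZero.pos M) hd) (by omega)

/-- A property of primes `p = x² + b²` that amounts, for `p > M`, to a condition on `x` modulo `M`,
holds for a number of primes proportional to the number of admissible classes. -/
theorem tendsto_card_filter_of_class (hHL : HardyLittlewoodConjecture) {M : ℕ} [NeZero M]
    (hM : Even M) {b : ℕ} (hb : b ≠ 0) {A : Finset (ZMod M)}
    (hA : ∀ c ∈ A, IsUnit (c ^ 2 + (b : ZMod M) ^ 2)) {P : ℕ → Prop} [DecidablePred P]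
    (hP : ∀ p x : ℕ, p.Prime → M < p → p = x ^ 2 + b ^ 2 → (P p ↔ (x : ZMod M) ∈ A)) :
    Tendsto (fun N : ℕ => (((sqAddPrimes b N).filter P).card : ℝ) / hlGrowth (N + 1)) atTop
      (𝓝 (A.card * hlConst ((M : ℤ) ^ 2) 0 ((b : ℤ) ^ 2))) := by
  set κ := hlConst ((M : ℤ) ^ 2) 0 ((b : ℤ) ^ 2)
  have hsum : ∀ N : ℕ, ((sqAddPrimes b N).filter fun p => sqAddClass M b p ∈ A).card
      = ∑ c ∈ A, ((sqAddPrimes b N).filter fun p => sqAddClass M b p = c).card := by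
    intro N
    rw [Finset.card_eq_sum_card_fiberwise (f := sqAddClass M b) (t := A)
      (s := (sqAddPrimes b N).filter fun p => sqAddClass M b p ∈ A)
      (fun p hp => (Finset.mem_filter.mp hp).2)]
    refine Finset.sum_congr rfl fun c hc => ?_
    rw [Finset.filter_filter]
    congr 1
    refine Finset.filter_congr fun p _ => ⟨fun h => h.2, fun h => ⟨h ▸ hc, h⟩⟩
  have hlim : Tendsto (fun N : ℕ =>
      (((sqAddPrimes b N).filter fun p => sqAddClass M b p ∈ A).card : ℝ) / hlGrowth (N + 1)) atTop
      (𝓝 (A.card * κ)) := by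
    simp_rw [hsum]
    push_cast
    simp_rw [Finset.sum_div]
    have := tendsto_finsetSum A fun c hc =>
      tendsto_card_filter_sqAddClass hHL hM hb (hA c hc)
    rwa [Finset.sum_const, nsmul_eq_mul] at this
  -- the two counts differ by at most the number of primes up to `M`
  have hdiff : ∀ N : ℕ, |(((sqAddPrimes b N).filter P).card : ℝ)
      - ((sqAddPrimes b N).filter fun p => sqAddClass M b p ∈ A).card| ≤ (M + 1 : ℕ) := by
    intro N
    have hiff : ∀ p ∈ sqAddPrimes b N, M < p → (P p ↔ sqAddClass M b p ∈ A) := by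
      intro p hp hMp
      obtain ⟨-, hpp, x, hx⟩ := mem_sqAddPrimes.mp hp
      rw [hP p x hpp hMp hx, hx, sqAddClass_eq]
    have h1 : ((sqAddPrimes b N).filter P) ⊆
        ((sqAddPrimes b N).filter fun p => sqAddClass M b p ∈ A) ∪ Finset.range (M + 1) := by
      intro p hp
      rw [Finset.mem_filter] at hp
      rw [Finset.mem_union, Finset.mem_filter, Finset.mem_range]
      rcases Nat.lt_or_ge M p with h | h
      · exact Or.inl ⟨hp.1, (hiff p hp.1 h).mp hp.2⟩
      · exact Or.inr (by omega)
    have h2 : ((sqAddPrimes b N).filter fun p => sqAddClass M b p ∈ A) ⊆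
        ((sqAddPrimes b N).filter P) ∪ Finset.range (M + 1) := by
      intro p hp
      rw [Finset.mem_filter] at hp
      rw [Finset.mem_union, Finset.mem_filter, Finset.mem_range]
      rcases Nat.lt_or_ge M p with h | h
      · exact Or.inl ⟨hp.1, (hiff p hp.1 h).mpr hp.2⟩
      · exact Or.inr (by omega)
    have h3 := (Finset.card_le_card h1).trans (Finset.card_union_le _ _)
    have h4 := (Finset.card_le_card h2).trans (Finset.card_union_le _ _)
    rw [Finset.card_range] at h3 h4
    have h3' : (((sqAddPrimes b N).filter P).card : ℝ) ≤
      ((sqAddPrimes b N).filter fun p => sqAddClass M b p ∈ A).card + (M + 1 : ℕ) := by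
      exact_mod_cast h3
    have h4' : (((sqAddPrimes b N).filter fun p => sqAddClass M b p ∈ A).card : ℝ) ≤
      ((sqAddPrimes b N).filter P).card + (M + 1 : ℕ) := by exact_mod_cast h4
    rw [abs_le]
    constructor <;> linarith
  have hzero : Tendsto (fun N : ℕ => ((((sqAddPrimes b N).filter P).card : ℝ)
      - ((sqAddPrimes b N).filter fun p => sqAddClass M b p ∈ A).card) / hlGrowth (N + 1)) atTop
      (𝓝 0) := by
    have h0 := ((tendsto_const_div_hlGrowth (M + 1 : ℕ)).comp (tendsto_add_atTop_nat 1)).abs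
    rw [abs_zero] at h0
    refine squeeze_zero_norm (fun N => ?_) h0
    simp only [Function.comp, Real.norm_eq_abs]
    rw [abs_div, abs_div]
    exact div_le_div_of_nonneg_right ((hdiff N).trans (le_abs_self _)) (abs_nonneg _)
  have := hzero.add hlim
  rw [zero_add] at this
  exact this.congr fun N => by ring

/-- If `A` is the set of classes of `x` for which the trace is `2 β`, among the set `S` of all admissible
classes, the density is the proportion of `A` in `S`. -/
theorem hasTraceDensity_of_class (hHL : HardyLittlewoodConjecture) {M : ℕ} [NeZero M]
    (hM : Even M) {D β : ℤ} (hβ : β ≠ 0) {A S : Finset (ZMod M)} (hAS : A ⊆ S) (hS0 : S.Nonempty)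
    (hS : ∀ c, c ∈ S ↔ IsUnit (c ^ 2 + (β.natAbs : ZMod M) ^ 2))
    (hP : ∀ p x : ℕ, p.Prime → M < p → p = x ^ 2 + β.natAbs ^ 2 →
      (¬ (p : ℤ) ∣ 2 * D ∧ frobTrace D p = 2 * β ↔ (x : ZMod M) ∈ A)) :
    HasTraceDensity D β (A.card / S.card) := by
  classical
  have hb : β.natAbs ≠ 0 := Int.natAbs_ne_zero.mpr hβ
  have hM0 : (M : ℤ) ≠ 0 := by exact_mod_cast NeZero.ne M
  have hκ := hlConst_shift_ne_zero (M := M) (β := (β.natAbs : ℤ)) (by exact_mod_cast hM) hM0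
    (by exact_mod_cast hb)
  have h1 := tendsto_card_filter_of_class hHL hM hb (fun c hc => (hS c).mp (hAS hc)) hP
  have h2 := tendsto_card_filter_of_class hHL hM hb (fun c hc => (hS c).mp hc)
    (P := fun _ => True) (fun p x hp hpM hpx => iff_of_true trivial
      ((hS _).mpr (isUnit_of_prime_eq_sq_add hp hpM hpx)))
  set κ := hlConst ((M : ℤ) ^ 2) 0 ((β.natAbs : ℤ) ^ 2)
  have hS1 : (S.card : ℝ) ≠ 0 := by
    exact_mod_cast (Finset.card_pos.mpr hS0).ne'
  have h3 := h1.div h2 (mul_ne_zero hS1 hκ)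
  rw [mul_div_mul_right _ _ hκ] at h3
  unfold HasTraceDensity
  refine h3.congr' ?_
  have hev := (tendsto_add_atTop_nat 1).eventually eventually_hlGrowth_ne_zero
  filter_upwards [hev] with N hN
  simp only [Pi.div_apply]
  rw [div_div_div_cancel_right₀ hN]
  congr 2
  · rw [← Set.ncard_coe_finset, Finset.coe_filter]
    congr 1
    ext p
    simp only [← coe_sqAddPrimes, Finset.mem_coe, Set.mem_ofPred_eq]
  · rw [← coe_sqAddPrimes, Set.ncard_coe_finset, Finset.filter_true_of_mem (fun _ _ => trivial)]

/-! ### Local character sums -/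

/-- After the substitution `u = c²` this is the evaluation of the Jacobi sum of the quadratic
character with itself. -/
theorem sum_quadraticChar_sq_add {F : Type*} [Field F] [Fintype F] [DecidableEq F]
    (hF : ringChar F ≠ 2) {B : F} (hB : B ≠ 0) : ∑ c : F, quadraticChar F (c ^ 2 + B) = -1 := by
  have h1 := sum_comp_sq (R := ℤ) hF (fun u => quadraticChar F (u + B))
  have h2 : ∑ u : F, quadraticChar F (u + B) = 0 := by
    rw [← quadraticChar_sum_zero hF]
    exact Equiv.sum_comp (Equiv.addRight B) fun u => quadraticChar F u
  have h3 : ∑ u : F, quadraticChar F u * quadraticChar F (u + B) = -1 := by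
    have hJ := jacobiSum_nontrivial_inv (quadraticChar_ne_one hF)
    rw [(quadraticChar_isQuadratic F).inv] at hJ
    have e : ∑ u : F, quadraticChar F u * quadraticChar F (u + B)
        = quadraticChar F (-1) * quadraticChar F B ^ 2
          * jacobiSum (quadraticChar F) (quadraticChar F) := by
      unfold jacobiSum
      rw [← Equiv.sum_comp (Equiv.mulLeft₀ (-B) (neg_ne_zero.mpr hB)), Finset.mul_sum]
      refine Finset.sum_congr rfl fun v _ => ?_
      simp only [Equiv.mulLeft₀_apply]
      rw [show -B * v + B = B * (1 - v) by ring, show -B * v = -1 * B * v by ring, map_mul, map_mul,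
        map_mul]
      ring
    rw [e, hJ, quadraticChar_sq_one hB, mul_one, mul_neg, ← sq,
      quadraticChar_sq_one (neg_ne_zero.mpr one_ne_zero)]
  rw [h1]
  simp_rw [add_mul, one_mul]
  rw [Finset.sum_add_distrib]
  simp only [Int.cast_id]
  rw [h2, h3, zero_add]

/-- The number of classes `c` modulo `n` with `c² + b²` a unit. -/
def localCount (b n : ℕ) [NeZero n] : ℤ :=
  ∑ c : ZMod n, if IsUnit (c ^ 2 + (b : ZMod n) ^ 2) then 1 else 0

/-- The sum of the `v`-th powers of the Jacobi symbols `(c² + b² | n)` over the same classes. -/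
def localSum (b v n : ℕ) [NeZero n] : ℤ :=
  ∑ c : ZMod n, if IsUnit (c ^ 2 + (b : ZMod n) ^ 2) then
    jacobiSym ((c.val : ℤ) ^ 2 + (b : ℤ) ^ 2) n ^ v else 0

theorem localCount_pos {b n : ℕ} [NeZero n] (h : ∃ c : ZMod n, IsUnit (c ^ 2 + (b : ZMod n) ^ 2)) :
    0 < localCount b n := by
  obtain ⟨c, hc⟩ := h
  refine Finset.sum_pos' (fun i _ => by split_ifs <;> norm_num) ⟨c, Finset.mem_univ _, ?_⟩
  rw [if_pos hc]; exact one_pos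

section LocalPrime

variable {l : ℕ} [Fact l.Prime] {b : ℕ}

theorem exists_isUnit_sq_add : ∃ c : ZMod l, IsUnit (c ^ 2 + (b : ZMod l) ^ 2) := by
  by_cases hb : (b : ZMod l) = 0
  · exact ⟨1, by rw [hb]; simp⟩
  · exact ⟨0, by
      rw [zero_pow two_ne_zero, zero_add, isUnit_iff_ne_zero]; exact pow_ne_zero _ hb⟩

theorem jacobiSym_val_sq_add (c : ZMod l) :
    jacobiSym ((c.val : ℤ) ^ 2 + (b : ℤ) ^ 2) l
      = quadraticChar (ZMod l) (c ^ 2 + (b : ZMod l) ^ 2) := by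
  rw [← jacobiSym.legendreSym.to_jacobiSym, legendreSym]
  push_cast
  rw [ZMod.natCast_zmod_val]

theorem localSum_eq_localCount {v : ℕ} (h : l ∣ b ∨ Even v) :
    localSum b v l = localCount b l := by
  unfold localSum localCount
  refine Finset.sum_congr rfl fun c _ => ?_
  split_ifs with hc
  · rw [jacobiSym_val_sq_add]
    have hc0 := hc.ne_zero
    rcases h with h | ⟨k, rfl⟩
    · rw [(ZMod.natCast_eq_zero_iff b l).mpr h] at hc0 ⊢
      rw [zero_pow two_ne_zero, add_zero] at hc0 ⊢
      rw [quadraticChar_sq_one' (by rintro rfl; simp at hc0), one_pow]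
    · rw [← two_mul, pow_mul, quadraticChar_sq_one hc0, one_pow]
  · rfl

theorem localSum_eq_neg_one {v : ℕ} (hl : l ≠ 2) (hb : ¬ l ∣ b) (hv : Odd v) :
    localSum b v l = -1 := by
  have hF : ringChar (ZMod l) ≠ 2 := by rwa [ZMod.ringChar_zmod_n]
  have hb0 : (b : ZMod l) ≠ 0 := by rwa [Ne, ZMod.natCast_eq_zero_iff]
  rw [← sum_quadraticChar_sq_add hF (pow_ne_zero 2 hb0)]
  unfold localSum
  refine Finset.sum_congr rfl fun c _ => ?_
  rw [jacobiSym_val_sq_add]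
  split_ifs with hc
  · obtain ⟨k, rfl⟩ := hv
    rw [pow_succ, pow_mul, quadraticChar_sq_one hc.ne_zero, one_pow, one_mul]
  · rw [isUnit_iff_ne_zero, not_not] at hc
    rw [hc, MulChar.map_zero]

theorem localCount_eq (hl : l ≠ 2) (hb : ¬ l ∣ b) :
    localCount b l = ((if l % 4 = 1 then l - 2 else l : ℕ) : ℤ) := by
  classical
  have hF : ringChar (ZMod l) ≠ 2 := by rwa [ZMod.ringChar_zmod_n]
  have hb0 : (b : ZMod l) ≠ 0 := by rwa [Ne, ZMod.natCast_eq_zero_iff]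
  have h1 : localCount b l = l - (({c : ZMod l | c ^ 2 = -(b : ZMod l) ^ 2}.toFinset.card : ℕ) : ℤ) := by
    have e : ∀ c : ZMod l, (if IsUnit (c ^ 2 + (b : ZMod l) ^ 2) then (1 : ℤ) else 0)
        = 1 - if c ^ 2 = -(b : ZMod l) ^ 2 then 1 else 0 := by
      intro c
      have : IsUnit (c ^ 2 + (b : ZMod l) ^ 2) ↔ ¬ c ^ 2 = -(b : ZMod l) ^ 2 := by
        rw [isUnit_iff_ne_zero, Ne, add_eq_zero_iff_eq_neg]
      simp only [this]
      split_ifs <;> simp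
    unfold localCount
    simp_rw [e]
    rw [Finset.sum_sub_distrib, Finset.sum_boole, Set.toFinset_ofPred]
    simp
  rw [h1, quadraticChar_card_sqrts hF, ← neg_one_mul, map_mul, quadraticChar_sq_one' hb0, mul_one,
    quadraticChar_neg_one hF, ZMod.card]
  have h2 : l % 2 = 1 := Nat.Prime.mod_two_eq_one_iff_ne_two (Fact.out : l.Prime) |>.mpr hl
  have h3 := (Fact.out : l.Prime).two_le
  split_ifs with h
  · rw [ZMod.χ₄_nat_one_mod_four h]
    omega
  · rw [ZMod.χ₄_nat_three_mod_four (by omega)]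
    omega

end LocalPrime

/-! ### Residue classes modulo `4 ∏ l` -/

/-- The moduli of the Chinese remainder decomposition: `4`, and the odd primes dividing `D`. -/
def crtModulus (D : ℤ) : Option (oddPrimes D) → ℕ
  | none => 4
  | some l => l

theorem prime_of_mem_oddPrimes {D : ℤ} {l : ℕ} (hl : l ∈ oddPrimes D) : l.Prime ∧ l ≠ 2 :=
  ⟨Nat.prime_of_mem_primeFactors (Finset.mem_of_mem_erase hl), Finset.ne_of_mem_erase hl⟩

instance (D : ℤ) (l : oddPrimes D) : Fact (l : ℕ).Prime :=
  ⟨(prime_of_mem_oddPrimes l.2).1⟩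

instance (D : ℤ) (i : Option (oddPrimes D)) : NeZero (crtModulus D i) := by
  rcases i with _ | l
  · exact ⟨by simp [crtModulus]⟩
  · exact ⟨(prime_of_mem_oddPrimes l.2).1.ne_zero⟩

theorem crtModulus_coprime (D : ℤ) : Pairwise (Function.onFun Nat.Coprime (crtModulus D)) := by
  have h4 : ∀ l : oddPrimes D, Nat.Coprime 4 (l : ℕ) := fun l => by
    obtain ⟨h1, h2⟩ := prime_of_mem_oddPrimes l.2
    exact Nat.Coprime.pow_left 2 ((Nat.coprime_primes Nat.prime_two h1).mpr h2.symm)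
  rintro (_ | l) (_ | l') hne
  · exact absurd rfl hne
  · exact h4 l'
  · exact (h4 l).symm
  · refine (Nat.coprime_primes (prime_of_mem_oddPrimes l.2).1 (prime_of_mem_oddPrimes l'.2).1).mpr
      fun h => hne ?_
    rw [Subtype.ext h]

/-- The modulus `4 ∏ l`, with `l` running over the odd primes dividing `D`. -/
def crtLevel (D : ℤ) : ℕ :=
  ∏ i, crtModulus D i

instance (D : ℤ) : NeZero (crtLevel D) :=
  ⟨Finset.prod_ne_zero_iff.mpr fun _ _ => NeZero.ne _⟩

theorem crtModulus_dvd_crtLevel (D : ℤ) (i : Option (oddPrimes D)) :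
    crtModulus D i ∣ crtLevel D :=
  Finset.dvd_prod_of_mem _ (Finset.mem_univ i)

theorem four_dvd_crtLevel (D : ℤ) : 4 ∣ crtLevel D :=
  crtModulus_dvd_crtLevel D none

theorem not_dvd_of_crtLevel_lt {D : ℤ} (hD : D ≠ 0) {p : ℕ} (hp : p.Prime) (h : crtLevel D < p) :
    ¬ (p : ℤ) ∣ D ∧ ¬ (p : ℤ) ∣ 2 * D := by
  have h4 := Nat.le_of_dvd (NeZero.pos _) (four_dvd_crtLevel D)
  have h1 : ¬ (p : ℤ) ∣ D := fun hd => by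
    have hm : p ∈ oddPrimes D := (mem_oddPrimes hD).mpr ⟨hp, by omega, hd⟩
    have := Nat.le_of_dvd (NeZero.pos _) (crtModulus_dvd_crtLevel D (some ⟨p, hm⟩))
    simp only [crtModulus] at this
    omega
  refine ⟨h1, fun hd => ?_⟩
  rcases (Nat.prime_iff_prime_int.mp hp).dvd_or_dvd hd with h2 | h2
  · have : p ∣ 2 := by exact_mod_cast h2
    have := Nat.le_of_dvd two_pos this
    omega
  · exact h1 h2

/-- The Chinese remainder isomorphism for the modulus `4 ∏ l`. -/
noncomputable def crtEquiv (D : ℤ) : ZMod (crtLevel D) ≃+* Π i, ZMod (crtModulus D i) :=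
  ZMod.prodEquivPi (crtModulus D) (crtModulus_coprime D)

theorem crtEquiv_natCast (D : ℤ) (x : ℕ) (i : Option (oddPrimes D)) :
    crtEquiv D x i = x := by
  rw [map_natCast, Pi.natCast_apply]

theorem sum_prod_crtEquiv (D : ℤ) (g : ∀ i, ZMod (crtModulus D i) → ℤ) :
    ∑ c, ∏ i, g i (crtEquiv D c i) = ∏ i, ∑ t, g i t := by
  rw [Finset.prod_univ_sum, Fintype.piFinset_univ]
  exact Equiv.sum_comp (crtEquiv D).toEquiv fun f => ∏ i, g i (f i)

theorem isUnit_sq_add_iff (D : ℤ) (b : ℕ) (c : ZMod (crtLevel D)) :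
    IsUnit (c ^ 2 + (b : ZMod (crtLevel D)) ^ 2) ↔
      ∀ i, IsUnit ((crtEquiv D c i) ^ 2 + (b : ZMod (crtModulus D i)) ^ 2) := by
  rw [← MulEquiv.isUnit_map (crtEquiv D), Pi.isUnit_iff]
  refine forall_congr' fun i => ?_
  rw [map_add, map_pow, map_pow, Pi.add_apply, Pi.pow_apply, Pi.pow_apply, crtEquiv_natCast]

/-- The classes `c` modulo `4 ∏ l` for which `c² + b²` is a unit. -/
def goodClasses (D : ℤ) (b : ℕ) : Finset (ZMod (crtLevel D)) :=
  Finset.univ.filter fun c => IsUnit (c ^ 2 + (b : ZMod (crtLevel D)) ^ 2)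

theorem mem_goodClasses {D : ℤ} {b : ℕ} {c : ZMod (crtLevel D)} :
    c ∈ goodClasses D b ↔ IsUnit (c ^ 2 + (b : ZMod (crtLevel D)) ^ 2) := by
  simp [goodClasses]

/-- The Jacobi symbol `(D | x² + b²)`, read off from the class of `x` by quadratic reciprocity. -/
noncomputable def classSign (D : ℤ) (b : ℕ) (c : ZMod (crtLevel D)) : ℤ :=
  ∏ l : oddPrimes D, jacobiSym (((crtEquiv D c (some l)).val : ℤ) ^ 2 + (b : ℤ) ^ 2) l
    ^ D.natAbs.factorization l

theorem classSign_natCast (D : ℤ) (b x : ℕ) :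
    classSign D b x = ∏ l ∈ oddPrimes D,
      jacobiSym ((x : ℤ) ^ 2 + (b : ℤ) ^ 2) l ^ D.natAbs.factorization l := by
  rw [classSign, ← Finset.prod_coe_sort (oddPrimes D)]
  refine Finset.prod_congr rfl fun l _ => ?_
  congr 1
  rw [crtEquiv_natCast]
  apply jacobiSym.mod_left'
  have : (((x : ZMod (crtModulus D (some l))).val : ℤ)) ≡ x [ZMOD (l : ℕ)] := by
    rw [ZMod.val_natCast]
    simp only [crtModulus]
    push_cast
    exact Int.mod_modEq _ _
  exact ((this.pow 2).add_right _)

theorem card_goodClasses (D : ℤ) (b : ℕ) :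
    ((goodClasses D b).card : ℤ) = localCount b 4 * ∏ l : oddPrimes D, localCount b l := by
  have h := sum_prod_crtEquiv D fun i t => if IsUnit (t ^ 2 + (b : ZMod (crtModulus D i)) ^ 2)
    then 1 else 0
  rw [Fintype.prod_option] at h
  change _ = localCount b 4 * ∏ l : oddPrimes D, localCount b l at h
  rw [← h, goodClasses, Finset.card_filter]
  push_cast
  refine Finset.sum_congr rfl fun c _ => ?_
  rw [Finset.prod_ite_zero, Finset.prod_const_one]
  simp only [isUnit_sq_add_iff, Finset.mem_univ, true_imp_iff]

theorem sum_classSign (D : ℤ) (b : ℕ) :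
    ∑ c ∈ goodClasses D b, classSign D b c
      = localCount b 4 * ∏ l : oddPrimes D, localSum b (D.natAbs.factorization l) l := by
  let w : ∀ i, ZMod (crtModulus D i) → ℤ := fun i =>
    match i with
    | none => fun _ => 1
    | some l => fun t => jacobiSym ((t.val : ℤ) ^ 2 + (b : ℤ) ^ 2) l ^ D.natAbs.factorization l
  have h := sum_prod_crtEquiv D fun i t => if IsUnit (t ^ 2 + (b : ZMod (crtModulus D i)) ^ 2)
    then w i t else 0
  rw [Fintype.prod_option] at h
  change _ = localCount b 4 * ∏ l : oddPrimes D, localSum b (D.natAbs.factorization l) l at h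
  rw [← h, goodClasses, Finset.sum_filter]
  refine Finset.sum_congr rfl fun c _ => ?_
  rw [Finset.prod_ite_zero, Fintype.prod_option]
  simp only [isUnit_sq_add_iff, Finset.mem_univ, true_imp_iff]
  simp only [w, one_mul]
  rfl

theorem localCount_four_pos {b : ℕ} (hb : Even b) : 0 < localCount b 4 := by
  refine localCount_pos ⟨1, ?_⟩
  obtain ⟨k, rfl⟩ := hb
  have : ((k + k : ℕ) : ZMod 4) ^ 2 = 0 := by
    have h4 : (4 : ZMod 4) = 0 := rfl
    push_cast
    linear_combination (k : ZMod 4) ^ 2 * h4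
  rw [this]
  simp

theorem card_goodClasses_pos (D : ℤ) {b : ℕ} (hb : Even b) : 0 < (goodClasses D b).card := by
  have h : (0 : ℤ) < (goodClasses D b).card := by
    rw [card_goodClasses]
    exact mul_pos (localCount_four_pos hb)
      (Finset.prod_pos fun l _ => localCount_pos exists_isUnit_sq_add)
  exact_mod_cast h

/-- The contribution of the prime `l` to the average of `(D | x² + b²)`. -/
noncomputable def localRatio (D : ℤ) (b l : ℕ) : ℝ :=
  if l ∣ b ∨ Even (D.natAbs.factorization l) then 1
  else -1 / ((if l % 4 = 1 then l - 2 else l : ℕ) : ℝ)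

theorem sum_classSign_div_card (D : ℤ) {b : ℕ} (hb : Even b) :
    ((∑ c ∈ goodClasses D b, classSign D b c : ℤ) : ℝ) / (goodClasses D b).card
      = ∏ l ∈ oddPrimes D, localRatio D b l := by
  have h1 : ((goodClasses D b).card : ℝ) = ((goodClasses D b).card : ℤ) := by norm_cast
  have h4 : ((localCount b 4 : ℤ) : ℝ) ≠ 0 := by exact_mod_cast (localCount_four_pos hb).ne'
  rw [h1, card_goodClasses, sum_classSign]
  push_cast
  rw [mul_div_mul_left _ _ h4, ← Finset.prod_div_distrib, ← Finset.prod_coe_sort (oddPrimes D)]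
  refine Finset.prod_congr rfl fun l _ => ?_
  have hl2 := (prime_of_mem_oddPrimes l.2).2
  have hpos : ((localCount b l : ℤ) : ℝ) ≠ 0 := by
    exact_mod_cast (localCount_pos (exists_isUnit_sq_add (l := l) (b := b))).ne'
  rw [localRatio]
  by_cases h : (l : ℕ) ∣ b ∨ Even (D.natAbs.factorization l)
  · rw [if_pos h, localSum_eq_localCount h, div_self hpos]
  · rw [if_neg h]
    rw [not_or, Nat.not_even_iff_odd] at h
    rw [localSum_eq_neg_one hl2 h.1 h.2, localCount_eq hl2 h.1, Int.cast_natCast, Int.cast_neg,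
      Int.cast_one]

theorem Finset.sum_one_sub_indicator {α : Type*} [DecidableEq α] {S A B : Finset α} (hA : A ⊆ S)
    (hB : B ⊆ S) {f : α → ℤ} (hf : ∀ c ∈ S,
      f c = 1 - 2 * (if c ∈ A then 1 else 0) - 2 * (if c ∈ B then 1 else 0)) :
    ∑ c ∈ S, f c = S.card - 2 * A.card - 2 * B.card := by
  rw [Finset.sum_congr rfl hf, Finset.sum_sub_distrib, Finset.sum_sub_distrib, ← Finset.mul_sum,
    ← Finset.mul_sum, Finset.sum_ite_mem, Finset.sum_ite_mem, Finset.inter_eq_right.mpr hA,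
    Finset.inter_eq_right.mpr hB]
  simp

/-! ### Equidistribution of the sign of the trace -/

theorem exists_prime_of_class (hHL : HardyLittlewoodConjecture) {M : ℕ} [NeZero M]
    (hM : Even M) {b : ℕ} (hb : b ≠ 0) {c : ZMod M} (hc : IsUnit (c ^ 2 + (b : ZMod M) ^ 2)) :
    ∃ p x : ℕ, p.Prime ∧ M < p ∧ p = x ^ 2 + b ^ 2 ∧ (x : ZMod M) = c := by
  by_contra hne
  push Not at hne
  have h := tendsto_card_filter_of_class hHL hM hb (A := {c})
    (fun c' hc' => by rw [Finset.mem_singleton.mp hc']; exact hc) (P := fun _ => False)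
    (fun p x hp hMp hpx => by simpa using hne p x hp hMp hpx)
  have hκ := hlConst_shift_ne_zero (M := M) (β := (b : ℤ)) (by exact_mod_cast hM)
    (by exact_mod_cast NeZero.ne M) (by exact_mod_cast hb)
  simp only [Finset.filter_false, Finset.card_empty, Nat.cast_zero, zero_div,
    Finset.card_singleton, Nat.cast_one, one_mul] at h
  exact hκ (tendsto_nhds_unique h tendsto_const_nhds)

open Classical in
/-- The classes of `x` modulo `4 ∏ l` that contain a large prime `x² + b²` with trace `2 t`. -/
noncomputable def traceClasses (D : ℤ) (b : ℕ) (t : ℤ) : Finset (ZMod (crtLevel D)) :=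
  (goodClasses D b).filter fun c => ∃ p x : ℕ, p.Prime ∧ crtLevel D < p ∧ p = x ^ 2 + b ^ 2 ∧
    (x : ZMod (crtLevel D)) = c ∧ frobTrace D p = 2 * t

theorem mem_traceClasses {D : ℤ} {b : ℕ} {t : ℤ} {c : ZMod (crtLevel D)} :
    c ∈ traceClasses D b t ↔ c ∈ goodClasses D b ∧ ∃ p x : ℕ, p.Prime ∧ crtLevel D < p ∧
      p = x ^ 2 + b ^ 2 ∧ (x : ZMod (crtLevel D)) = c ∧ frobTrace D p = 2 * t := by
  classical
  rw [traceClasses, Finset.mem_filter]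

theorem traceClasses_subset (D : ℤ) (b : ℕ) (t : ℤ) : traceClasses D b t ⊆ goodClasses D b :=
  fun _ hc => (mem_traceClasses.mp hc).1

/-- The class modulo `4 ∏ l` that is `1` modulo `4` and `-1` modulo every `l`. -/
noncomputable def flipClass (D : ℤ) : ZMod (crtLevel D) :=
  (crtEquiv D).symm fun i => match i with
    | none => 1
    | some _ => -1

theorem flipClass_mul_self (D : ℤ) : flipClass D * flipClass D = 1 := by
  apply (crtEquiv D).injective
  rw [map_mul, map_one, flipClass, RingEquiv.apply_symm_apply]
  funext i
  rcases i with _ | l <;> simp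

section Trace

variable {D β : ℤ} (hD : Odd D ∨ ((4 : ℤ) ∣ D ∧ ¬ (8 : ℤ) ∣ D)) (hβ : Even β) (hβ0 : β ≠ 0)

include hD hβ hβ0

/-- The trace depends only on the class of `x`, and `flipClass` exchanges the traces `2 β` and
`-2 β`. -/
theorem frobTrace_iff_of_class_eq {p p' x x' : ℕ} (hp : p.Prime) (hp' : p'.Prime)
    (hMp : crtLevel D < p) (hMp' : crtLevel D < p') (h : p = x ^ 2 + β.natAbs ^ 2)
    (h' : p' = x' ^ 2 + β.natAbs ^ 2) :
    ((x : ZMod (crtLevel D)) = x' →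
      (frobTrace D p = 2 * β ↔ frobTrace D p' = 2 * β) ∧
      (frobTrace D p = 2 * -β ↔ frobTrace D p' = 2 * -β)) ∧
    ((x : ZMod (crtLevel D)) = flipClass D * x' →
      (frobTrace D p = 2 * β ↔ frobTrace D p' = 2 * -β) ∧
      (frobTrace D p = 2 * -β ↔ frobTrace D p' = 2 * β)) := by
  have h0 := ne_zero_of_odd_or_four_dvd hD
  have hz : (x : ℤ) ^ 2 + β ^ 2 = p := by rw [h]; push_cast; rw [sq_abs]
  have hz' : (x' : ℤ) ^ 2 + β ^ 2 = p' := by rw [h']; push_cast; rw [sq_abs]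
  have key := fun h4 => frobTrace_eq_iff_of_modEq hp hp' hz hz' hβ hβ0 hD
    (not_dvd_of_crtLevel_lt h0 hp hMp).1 (not_dvd_of_crtLevel_lt h0 hp' hMp').1 h4
  constructor
  · intro hx
    have hi : ∀ i, ((x : ℤ) : ZMod (crtModulus D i)) = (x' : ℤ) := fun i => by
      have := congrFun (congrArg (crtEquiv D) hx) i
      rw [crtEquiv_natCast, crtEquiv_natCast] at this
      exact_mod_cast this
    refine (key ((ZMod.intCast_eq_intCast_iff _ _ 4).mp (hi none))).1 fun l hl => ?_
    exact (ZMod.intCast_eq_intCast_iff _ _ l).mp (hi (some ⟨l, hl⟩))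
  · intro hx
    have hi : ∀ i, (x : ZMod (crtModulus D i)) = crtEquiv D (flipClass D) i * x' := fun i => by
      have := congrFun (congrArg (crtEquiv D) hx) i
      rwa [map_mul, Pi.mul_apply, crtEquiv_natCast, crtEquiv_natCast] at this
    rw [flipClass, RingEquiv.apply_symm_apply] at hi
    have h4 : ((x : ℤ) : ZMod 4) = (x' : ℤ) := by
      have := hi none
      rw [one_mul] at this
      exact_mod_cast this
    refine (key ((ZMod.intCast_eq_intCast_iff _ _ 4).mp h4)).2 fun l hl => ?_
    refine (ZMod.intCast_eq_intCast_iff _ _ l).mp ?_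
    have := hi (some ⟨l, hl⟩)
    rw [neg_one_mul] at this
    push_cast
    exact this

theorem mem_traceClasses_iff {p x : ℕ} (hp : p.Prime) (hMp : crtLevel D < p)
    (h : p = x ^ 2 + β.natAbs ^ 2) :
    ((x : ZMod (crtLevel D)) ∈ traceClasses D β.natAbs β ↔ frobTrace D p = 2 * β) ∧
    ((x : ZMod (crtLevel D)) ∈ traceClasses D β.natAbs (-β) ↔ frobTrace D p = 2 * -β) := by
  have hgood := mem_goodClasses.mpr (isUnit_of_prime_eq_sq_add (M := crtLevel D) hp hMp h)
  constructor
  all_goals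
    rw [mem_traceClasses]
    constructor
    · rintro ⟨-, p', x', hp', hMp', h', hx, ht⟩
      have key := (frobTrace_iff_of_class_eq hD hβ hβ0 hp' hp hMp' hMp h' h).1 hx
      first | exact key.1.mp ht | exact key.2.mp ht
    · exact fun ht => ⟨hgood, p, x, hp, hMp, h, rfl, ht⟩

/-- Multiplication by `flipClass` is a bijection between the classes of trace `2 β` and `-2 β`. -/
theorem card_traceClasses_neg (hHL : HardyLittlewoodConjecture) :
    (traceClasses D β.natAbs (-β)).card = (traceClasses D β.natAbs β).card := by
  have hM : Even (crtLevel D) :=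
    even_iff_two_dvd.mpr (dvd_trans (by norm_num) (four_dvd_crtLevel D))
  have hb : β.natAbs ≠ 0 := Int.natAbs_ne_zero.mpr hβ0
  have hff : ∀ c, flipClass D * (flipClass D * c) = c := fun c => by
    rw [← mul_assoc, flipClass_mul_self, one_mul]
  have hgood : ∀ c ∈ goodClasses D β.natAbs, flipClass D * c ∈ goodClasses D β.natAbs := by
    intro c hc
    rw [mem_goodClasses] at hc ⊢
    rwa [mul_pow, sq (flipClass D), flipClass_mul_self, one_mul]
  refine Finset.card_nbij' (flipClass D * ·) (flipClass D * ·) ?_ ?_ (fun c _ => hff c)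
    (fun c _ => hff c)
  all_goals
    intro c hc
    have hc' : c ∈ goodClasses D β.natAbs := traceClasses_subset _ _ _ hc
    obtain ⟨p, x, hp, hMp, hpx, rfl⟩ := exists_prime_of_class hHL hM hb (mem_goodClasses.mp hc')
    obtain ⟨p', x', hp', hMp', hpx', hx'⟩ :=
      exists_prime_of_class hHL hM hb (mem_goodClasses.mp (hgood _ hc'))
    have key := (frobTrace_iff_of_class_eq hD hβ hβ0 hp' hp hMp' hMp hpx' hpx).2 hx'
    have m := mem_traceClasses_iff hD hβ hβ0 hp hMp hpx
    have m' := mem_traceClasses_iff hD hβ hβ0 hp' hMp' hpx'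
    rw [hx'] at m'
    first
      | exact m'.1.mpr (key.1.mpr (m.2.mp hc))
      | exact m'.2.mpr (key.2.mpr (m.1.mp hc))

/-- Half of the classes with `(D | x² + β²) = -1` have trace `2 β`, the other half `-2 β`. -/
theorem sum_classSign_eq (hHL : HardyLittlewoodConjecture) :
    ∑ c ∈ goodClasses D β.natAbs, classSign D β.natAbs c
      = (goodClasses D β.natAbs).card - 4 * (traceClasses D β.natAbs β).card := by
  have hM : Even (crtLevel D) :=
    even_iff_two_dvd.mpr (dvd_trans (by norm_num) (four_dvd_crtLevel D))
  have hb : β.natAbs ≠ 0 := Int.natAbs_ne_zero.mpr hβ0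
  have h0 := ne_zero_of_odd_or_four_dvd hD
  have hval : ∀ c ∈ goodClasses D β.natAbs, classSign D β.natAbs c
      = 1 - 2 * (if c ∈ traceClasses D β.natAbs β then 1 else 0)
        - 2 * (if c ∈ traceClasses D β.natAbs (-β) then 1 else 0) := by
    intro c hc
    obtain ⟨p, x, hp, hMp, hpx, rfl⟩ := exists_prime_of_class hHL hM hb (mem_goodClasses.mp hc)
    have m := mem_traceClasses_iff hD hβ hβ0 hp hMp hpx
    have hz : (x : ℤ) ^ 2 + β ^ 2 = p := by rw [hpx]; push_cast; rw [sq_abs]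
    have hiff := frobTrace_eq_or_eq_iff hp hz hβ hβ0 hD (not_dvd_of_crtLevel_lt h0 hp hMp).1
    have hs : classSign D β.natAbs x = ∏ l ∈ oddPrimes D,
        jacobiSym ((x : ℤ) ^ 2 + β ^ 2) l ^ D.natAbs.factorization l := by
      rw [classSign_natCast, Int.natCast_natAbs, sq_abs]
    rw [← hs, ← m.1, ← m.2] at hiff
    have hsq : classSign D β.natAbs x = 1 ∨ classSign D β.natAbs x = -1 := by
      apply Int.isUnit_iff.mp
      rw [hs]
      refine (Submonoid.prod_mem (IsUnit.submonoid ℤ) fun l hl => ?_)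
      refine IsUnit.pow _ (Int.isUnit_iff.mpr (jacobiSym.eq_one_or_neg_one ?_))
      rw [hz]
      obtain ⟨hl1, -, hl3⟩ := (mem_oddPrimes h0).mp hl
      rw [Int.gcd_natCast_natCast]
      refine (Nat.coprime_primes hp hl1).mpr ?_
      rintro rfl
      exact (not_dvd_of_crtLevel_lt h0 hp hMp).1 hl3
    have hexcl : ¬ ((x : ZMod (crtLevel D)) ∈ traceClasses D β.natAbs β ∧
        (x : ZMod (crtLevel D)) ∈ traceClasses D β.natAbs (-β)) := by
      rw [m.1, m.2]
      rintro ⟨h1, h2⟩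
      omega
    by_cases c1 : (x : ZMod (crtLevel D)) ∈ traceClasses D β.natAbs β <;>
      by_cases c2 : (x : ZMod (crtLevel D)) ∈ traceClasses D β.natAbs (-β)
    · exact absurd ⟨c1, c2⟩ hexcl
    · rw [hiff.mp (Or.inl c1), if_pos c1, if_neg c2]; norm_num
    · rw [hiff.mp (Or.inr c2), if_neg c1, if_pos c2]; norm_num
    · rw [if_neg c1, if_neg c2]
      rcases hsq with h | h
      · rw [h]; norm_num
      · exact absurd (hiff.mpr h) (not_or.mpr ⟨c1, c2⟩)
  rw [Finset.sum_one_sub_indicator (traceClasses_subset _ _ _) (traceClasses_subset _ _ _) hval,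
    card_traceClasses_neg hD hβ hβ0 hHL]
  ring

/-- The densities of the traces `2 β` and `-2 β`, in terms of the average of the sign
`(D | x² + β²)`. -/
theorem hasTraceDensity_prod_localRatio (hHL : HardyLittlewoodConjecture) :
    HasTraceDensity D β (1 / 4 * (1 - ∏ l ∈ oddPrimes D, localRatio D β.natAbs l)) ∧
    HasTraceDensity D (-β) (1 / 4 * (1 - ∏ l ∈ oddPrimes D, localRatio D β.natAbs l)) := by
  have hM : Even (crtLevel D) :=
    even_iff_two_dvd.mpr (dvd_trans (by norm_num) (four_dvd_crtLevel D))
  have h0 := ne_zero_of_odd_or_four_dvd hD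
  have hbe : Even β.natAbs := Int.natAbs_even.mpr hβ
  have hpos := card_goodClasses_pos D hbe
  have hposr : ((goodClasses D β.natAbs).card : ℝ) ≠ 0 := by exact_mod_cast hpos.ne'
  have hratio : ((traceClasses D β.natAbs β).card : ℝ) / (goodClasses D β.natAbs).card
      = 1 / 4 * (1 - ∏ l ∈ oddPrimes D, localRatio D β.natAbs l) := by
    rw [← sum_classSign_div_card D hbe, sum_classSign_eq hD hβ hβ0 hHL]
    push_cast
    field_simp
    ring
  constructor
  · rw [← hratio]
    refine hasTraceDensity_of_class hHL hM hβ0 (traceClasses_subset _ _ _) (Finset.card_pos.mp hpos)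
      (fun c => mem_goodClasses) fun p x hp hMp hpx => ?_
    rw [(mem_traceClasses_iff hD hβ hβ0 hp hMp hpx).1]
    exact and_iff_right (not_dvd_of_crtLevel_lt h0 hp hMp).2
  · rw [← hratio, ← card_traceClasses_neg hD hβ hβ0 hHL]
    refine hasTraceDensity_of_class hHL hM (neg_ne_zero.mpr hβ0) (traceClasses_subset _ _ _)
      (Finset.card_pos.mp hpos) (fun c => by rw [Int.natAbs_neg]; exact mem_goodClasses)
      fun p x hp hMp hpx => ?_
    rw [Int.natAbs_neg] at hpx
    rw [(mem_traceClasses_iff hD hβ hβ0 hp hMp hpx).2]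
    exact and_iff_right (not_dvd_of_crtLevel_lt h0 hp hMp).2

end Trace

/-! ### The closed formula -/

theorem factorization_prod_of_primes {s : Finset ℕ} (hs : ∀ l ∈ s, l.Prime) {l : ℕ} (hl : l ∈ s) :
    (∏ q ∈ s, q).factorization l = 1 := by
  rw [Nat.factorization_prod fun q hq => (hs q hq).ne_zero, Finset.sum_apply',
    Finset.sum_eq_single_of_mem l hl]
  · exact (hs l hl).factorization_self
  · intro q hq hne
    rw [(hs q hq).factorization, Finsupp.single_eq_of_ne hne.symm]

theorem tau_prod_of_primes {s : Finset ℕ} (hs : ∀ l ∈ s, l.Prime) :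
    tau (∏ l ∈ s, l) = ∏ l ∈ s, if l % 4 = 1 then l - 2 else l := by
  rw [tau, Nat.primeFactors_prod hs]
  refine Finset.prod_congr rfl fun l hl => ?_
  simp [factorization_prod_of_primes hs hl]

theorem prime_of_mem_oddPrimesExp {n : ℤ} {i l : ℕ} (hl : l ∈ oddPrimesExp n i) : l.Prime :=
  Nat.prime_of_mem_primeFactors (Finset.mem_filter.mp hl).1

theorem disjoint_oddPrimesExp {n : ℤ} {i j : ℕ} (hij : i ≠ j) :
    Disjoint (oddPrimesExp n i) (oddPrimesExp n j) := by
  rw [Finset.disjoint_left]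
  intro l hi hj
  exact hij ((Finset.mem_filter.mp hi).2.2.symm.trans (Finset.mem_filter.mp hj).2.2)

/-- `densityValue` as a product over the odd primes of exponent `1` or `3`. -/
theorem densityValue_eq_prod (n : ℤ) :
    densityValue n = 1 / 4 * (1 - ∏ l ∈ oddPrimesExp n 1 ∪ oddPrimesExp n 3,
      (-1 / ((if l % 4 = 1 then l - 2 else l : ℕ) : ℝ))) := by
  have hdisj : Disjoint (oddPrimesExp n 1) (oddPrimesExp n 3) := disjoint_oddPrimesExp (by norm_num)
  have hprime : ∀ l ∈ oddPrimesExp n 1 ∪ oddPrimesExp n 3, l.Prime := fun l hl =>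
    (Finset.mem_union.mp hl).elim prime_of_mem_oddPrimesExp prime_of_mem_oddPrimesExp
  rw [densityValue, ← Finset.prod_union hdisj, ← Finset.card_union_of_disjoint hdisj,
    tau_prod_of_primes hprime, Finset.prod_div_distrib, Finset.prod_const, Nat.cast_prod]

/-- The primes with a nontrivial local ratio: an odd prime divides `dbar` if and only if it divides
`D` but not `β`, and then it has the same exponent in both. -/
theorem IsSplitting.oddPrimesExp_union {D β d dbar : ℤ} (hsplit : IsSplitting D β d dbar)
    (hD0 : D ≠ 0) (hDfree : ∀ l : ℕ, l.Prime → ¬ ((l : ℤ) ^ 4 ∣ D)) :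
    oddPrimesExp dbar 1 ∪ oddPrimesExp dbar 3
      = (oddPrimes D).filter fun l => ¬ (l ∣ β.natAbs ∨ Even (D.natAbs.factorization l)) := by
  have hd0 : d ≠ 0 := hsplit.pos.ne'
  have hb0 : dbar ≠ 0 := fun h => hD0 (by rw [hsplit.eq_mul, h, mul_zero])
  have hfac : ∀ l : ℕ, ¬ (l : ℤ) ∣ d →
      D.natAbs.factorization l = dbar.natAbs.factorization l := fun l hl => by
    rw [hsplit.eq_mul, Int.natAbs_mul, Nat.factorization_mul (Int.natAbs_ne_zero.mpr hd0)
      (Int.natAbs_ne_zero.mpr hb0), Finsupp.add_apply,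
      Nat.factorization_eq_zero_of_not_dvd (fun h => hl (Int.natCast_dvd.mpr h)), zero_add]
  have hlt : ∀ l : ℕ, l.Prime → D.natAbs.factorization l < 4 := fun l hl => by
    by_contra! h
    refine hDfree l hl ?_
    have := (hl.pow_dvd_iff_le_factorization (Int.natAbs_ne_zero.mpr hD0)).mpr h
    exact_mod_cast Int.natCast_dvd.mpr this
  ext l
  simp only [oddPrimesExp, Finset.mem_union, Finset.mem_filter, Nat.mem_primeFactors,
    mem_oddPrimes hD0, ← Int.natCast_dvd]
  constructor
  · intro h
    obtain ⟨hl, hdvd, hl2, hexp⟩ : l.Prime ∧ (l : ℤ) ∣ dbar ∧ l ≠ 2 ∧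
        (dbar.natAbs.factorization l = 1 ∨ dbar.natAbs.factorization l = 3) := by tauto
    have hβ := hsplit.not_dvd_of_dvd l hl hl2 hdvd
    rw [hfac l fun h => hβ (hsplit.dvd_of_dvd l hl h)]
    refine ⟨⟨hl, hl2, hsplit.eq_mul ▸ hdvd.mul_left d⟩, ?_⟩
    rintro (h | h)
    · exact hβ h
    · rcases hexp with e | e <;> rw [e] at h <;> exact absurd h (by decide)
  · rintro ⟨⟨hl, hl2, hdvd⟩, h⟩
    obtain ⟨hβ, hodd⟩ := not_or.mp h
    have hd : ¬ (l : ℤ) ∣ d := fun h => hβ (hsplit.dvd_of_dvd l hl h)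
    have hdvd' : (l : ℤ) ∣ dbar :=
      ((Nat.prime_iff_prime_int.mp hl).dvd_or_dvd (hsplit.eq_mul ▸ hdvd)).resolve_left hd
    have hl4 := hlt l hl
    rw [hfac l hd] at hodd hl4
    have hexp : dbar.natAbs.factorization l = 1 ∨ dbar.natAbs.factorization l = 3 := by
      obtain ⟨k, hk⟩ := Nat.not_even_iff_odd.mp hodd
      omega
    have hb0' := Int.natAbs_ne_zero.mpr hb0
    tauto

theorem IsSplitting.densityValue_eq {D β d dbar : ℤ} (hsplit : IsSplitting D β d dbar)
    (hD0 : D ≠ 0) (hDfree : ∀ l : ℕ, l.Prime → ¬ ((l : ℤ) ^ 4 ∣ D)) :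
    densityValue dbar = 1 / 4 * (1 - ∏ l ∈ oddPrimes D, localRatio D β.natAbs l) := by
  rw [densityValue_eq_prod, hsplit.oddPrimesExp_union hD0 hDfree, Finset.prod_filter]
  congr 2
  refine Finset.prod_congr rfl fun l _ => ?_
  rw [localRatio, ite_not]

theorem mainTheorem11 (hHL : HardyLittlewoodConjecture)
    (D β d dbar : ℤ)
    (hDfree : ∀ l : ℕ, l.Prime → ¬ ((l : ℤ) ^ 4 ∣ D))
    (hD : Odd D ∨ ((4 : ℤ) ∣ D ∧ ¬ (8 : ℤ) ∣ D))
    (hβpos : 0 < β) (hβeven : Even β)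
    (hsplit : IsSplitting D β d dbar) :
    (d = 1 →
      HasTraceDensity D β (densityValue D) ∧ HasTraceDensity D (-β) (densityValue D)) ∧
    ((∀ l : ℕ, l.Prime → l ≠ 2 → ¬ (l : ℤ) ∣ dbar) →
      HasTraceDensity D β 0 ∧ HasTraceDensity D (-β) 0) ∧
    ((∃ l : ℕ, l.Prime ∧ l ≠ 2 ∧ (l : ℤ) ∣ dbar) →
      HasTraceDensity D β (densityValue dbar) ∧
      HasTraceDensity D (-β) (densityValue dbar)) := by
  have key := hasTraceDensity_prod_localRatio hD hβeven hβpos.ne' hHL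
  rw [← hsplit.densityValue_eq (ne_zero_of_odd_or_four_dvd hD) hDfree] at key
  refine ⟨fun hd => ?_, fun hnone => ?_, fun _ => key⟩
  · have hdbar : D = dbar := by rw [hsplit.eq_mul, hd, one_mul]
    rwa [← hdbar] at key
  · have hempty : ∀ i, oddPrimesExp dbar i = ∅ := fun i =>
      Finset.filter_eq_empty_iff.mpr fun l hl h =>
        hnone l (Nat.prime_of_mem_primeFactors hl) h.1
          (Int.natCast_dvd.mpr (Nat.dvd_of_mem_primeFactors hl))
    have hzero : densityValue dbar = 0 := by
      rw [densityValue_eq_prod, hempty, hempty]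
      simp
    rwa [hzero] at key
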